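/- Let $G$ be a finite connected multigraph with oriented edges $e\colon e^-\to e^+$, let $\ell\colon E(G)\to\mathbb{R}_{>0}$, and let $C$ be the tropical curve (metric graph) with model $(G,\ell)$. Let $H_1=H_1(G,\mathbb{Z})\subset C_1(G,\mathbb{Z})=\mathbb{Z}^{E(G)}$, $N=\operatorname{Hom}(H_1,\mathbb{Z})$, and $N_A=A\otimes N=\operatorname{Hom}(H_1,A)$ for a commutative ring $A$. Given $x\colon E(G)\to A$, let $[\cdot,\cdot]$ be the bilinear pairing on $C_1(G,\mathbb{Z})$ with $[e,e]=x_e$ and $[e,e']=0$ for $e\ne e'$; set $\pi(c)=[c,\cdot]\in N_A$, and let $n_e\in N$ be the functional "coefficient at $e$", so that $\pi(e)=x_en_e$. *Universal side.* Let $R=\mathbb{Z}[x_e\mid e\in E(G)]$, $A=R$, and $\Lambda=\pi(H_1)\subset N_R$. Let $C_q$ be the free abelian group on the ordered simplices $(u_0,\dots,u_q)\in N_R^{q+1}$ modulo simultaneous translation by elements of $\Lambda$, with the usual boundary $\partial$, and let $C_{1,q}=N\otimes C_q$. Define $\Theta\colon C_{1,2}\to\bigwedge^3_RN_R$ by $\Theta(n\otimes(u_0,u_1,u_2))=n\wedge(u_1-u_0)\wedge(u_2-u_0)$,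 and let $\mathscr{P}$ be the image under $\Theta$ of the cycles in $C_{1,2}$. For a vertex $v$ let $$\mathrm{Cer}_v(G)=\sum_en_e\otimes\big((\pi(\delta_e),\pi(\delta_e+e))+(-\pi(\delta_e),-\pi(\delta_e+e))\big)\in C_{1,1},$$ where $\delta_e$ is a path from $v$ to $e^-$. The universal Ceresa period $\alpha(G)$ is the class of $\Theta(\Sigma)$ in $\bigwedge^3_RN_R/\mathscr{P}$ for any $\Sigma\in C_{1,2}$ with $\partial\Sigma=\mathrm{Cer}_v(G)$. *Tropical side.* Take $A=\mathbb{R}$, $x=\ell$, write $\pi_C$ for the corresponding map $\pi$, and put $\Lambda_C=\pi_C(H_1)\subset N_{\mathbb{R}}$ and $\mathrm{Jac}(C)=N_{\mathbb{R}}/\Lambda_C$. Let $S_\bullet$ be the complex of smooth singular chains of $\mathrm{Jac}(C)$ and $S_{1,q}=N\otimes S_q$. Choose a basis $\epsilon_1,\dots,\epsilon_g$ of $N$, with associated coordinates $z_1,\dots,z_g$ on $N_{\mathbb{R}}$, and define $\Theta_C\colon S_{1,2}\to\bigwedge^3_{\mathbb{R}}N_{\mathbb{R}}$ by $$\Theta_C(n\otimes\sigma)=2\sum_{i<j<k}\Big(\int_\sigma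 n_i\,dz_j\wedge dz_k-n_j\,dz_i\wedge dz_k+n_k\,dz_i\wedge dz_j\Big)\,\epsilon_i\wedge\epsilon_j\wedge\epsilon_k .$$ Let $\mathscr{P}_C$ be the image under $\Theta_C$ of the cycles in $S_{1,2}$. For a point $p\in C$, let $\mathrm{Cer}_p(C)\in S_{1,1}$ be given by the formula above with $\pi_C$ in place of $\pi$ and with affine simplices of $\mathrm{Jac}(C)$, the sum being over the edges of $G$ after subdividing, if necessary, the edge containing $p$ in its interior (so that $p$ becomes a vertex), and $\delta_e$ being a path from $p$ to $e^-$. The Ceresa period $\alpha(C)$ is the class of $\Theta_C(\Sigma)$ in $\bigwedge^3_{\mathbb{R}}N_{\mathbb{R}}/\mathscr{P}_C$ for any $\Sigma\in S_{1,2}$ with $\partial\Sigma=\mathrm{Cer}_p(C)$. Let $\mathrm{ev}$ denote the ring map $R\to\mathbb{R}$, $x_e\mapsto\ell(e)$, and the induced maps $N_R\to N_{\mathbb{R}}$ and $\bigwedge^3_RN_R\to\bigwedge^3_{\mathbb{R}}N_{\mathbb{R}}$. **Proposition.** For all base points $v\in V(G)$ and $p\in C$, chains $\Sigma$ as above exist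 on both sides. Moreover $\mathrm{ev}(\mathscr{P})=\mathscr{P}_C$, and the induced map $\bigwedge^3_RN_R/\mathscr{P}\to\bigwedge^3_{\mathbb{R}}N_{\mathbb{R}}/\mathscr{P}_C$ sends $\alpha(G)$ to $\alpha(C)$, for every choice of the base points $v$ and $p$. In particular, if $\alpha(G)=0$, then $\alpha(C)=0$. -/

import Mathlib

open scoped TensorProduct ContDiff

noncomputable section

namespace Ceresa

/-! ### Exterior powers under a change of the base ring -/

/-- A semilinear map `f : M → M'` over a ring map `φ : A → B` induces a semilinear map of
exterior powers, `v₁ ∧ ⋯ ∧ vₖ ↦ f v₁ ∧ ⋯ ∧ f vₖ`. -/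
def extMap {A B : Type*} [CommRing A] [CommRing B] (φ : A →+* B) {M M' : Type*}
    [AddCommGroup M] [Module A M] [AddCommGroup M'] [Module B M'] (k : ℕ) (f : M →ₛₗ[φ] M') :
    ⋀[A]^k M →ₛₗ[φ] ⋀[B]^k M' :=
  letI : Module A (⋀[B]^k M') := Module.compHom _ φ
  let a : M [⋀^Fin k]→ₗ[A] ⋀[B]^k M' :=
    { toFun := fun v => exteriorPower.ιMulti B k (fun i => f (v i))
      map_update_add' := by
        intro _ m i x y
        have h : ∀ z : M, (fun j => f (Function.update m i z j))
            = Function.update (fun j => f (m j)) i (f z) := by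
          intro z; ext j; by_cases hj : j = i
          · subst hj; simp
          · simp [hj]
        simp only [h, map_add, AlternatingMap.map_update_add]
      map_update_smul' := by
        intro _ m i c x
        have h : ∀ z : M, (fun j => f (Function.update m i z j))
            = Function.update (fun j => f (m j)) i (f z) := by
          intro z; ext j; by_cases hj : j = i
          · subst hj; simp
          · simp [hj]
        simp only [h, map_smulₛₗ, AlternatingMap.map_update_smul]
        rfl
      map_eq_zero_of_eq' := by
        intro v i j hv hij
        exact AlternatingMap.map_eq_zero_of_eq _ _ (by simp [hv]) hij }
  { toFun := exteriorPower.alternatingMapLinearEquiv a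
    map_add' := fun x y => map_add _ x y
    map_smul' := fun c x => LinearMap.map_smul (exteriorPower.alternatingMapLinearEquiv a) c x }

theorem extMap_ιMulti {A B : Type*} [CommRing A] [CommRing B] (φ : A →+* B) {M M' : Type*}
    [AddCommGroup M] [Module A M] [AddCommGroup M'] [Module B M'] (k : ℕ) (f : M →ₛₗ[φ] M')
    (v : Fin k → M) :
    extMap φ k f (exteriorPower.ιMulti A k v) = exteriorPower.ιMulti B k (fun i => f (v i)) := by
  let _ : Module A (⋀[B]^k M') := Module.compHom _ φ
  exact exteriorPower.alternatingMapLinearEquiv_apply_ιMulti _ _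

/-- `a ∧ b ∧ c` in the third exterior power. -/
def wedge (A : Type*) [CommRing A] {M : Type*} [AddCommGroup M] [Module A M] (a b c : M) :
    ⋀[A]^3 M :=
  exteriorPower.ιMulti A 3 ![a, b, c]

/-! ### Graphs, their homology, and the length pairing -/

/-- A connected multigraph (loops and parallel edges allowed) with a chosen orientation:
`e` runs from `tail e` (the vertex `e⁻`) to `head e` (the vertex `e⁺`). -/
structure MGraph (V E : Type*) where
  tail : E → V
  head : E → V
  nonempty : Nonempty V
  connected : ∀ v w : V, Relation.EqvGen (fun a b => ∃ e, tail e = a ∧ head e = b) v w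

namespace MGraph

variable {V E : Type*} (G : MGraph V E)

/-- The boundary `C₁(G, ℤ) → C₀(G, ℤ)`, `e ↦ e⁺ - e⁻`. -/
def bdry : (E →₀ ℤ) →ₗ[ℤ] (V →₀ ℤ) :=
  Finsupp.linearCombination ℤ
    (fun e => Finsupp.single (G.head e) (1 : ℤ) - Finsupp.single (G.tail e) 1)

/-- `H₁(G, ℤ) ⊆ C₁(G, ℤ)`. -/
def H1 : Submodule ℤ (E →₀ ℤ) := LinearMap.ker G.bdry

/-- `N = H¹(G, ℤ) = Hom(H₁(G, ℤ), ℤ)`. -/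
def N : Type _ := G.H1 →+ ℤ

instance : AddCommGroup G.N := inferInstanceAs (AddCommGroup (G.H1 →+ ℤ))

instance : FunLike G.N G.H1 ℤ := inferInstanceAs (FunLike (G.H1 →+ ℤ) G.H1 ℤ)

instance : AddMonoidHomClass G.N G.H1 ℤ :=
  inferInstanceAs (AddMonoidHomClass (G.H1 →+ ℤ) G.H1 ℤ)

/-- `N_A = A ⊗ N = H¹(G, A) = Hom(H₁(G, ℤ), A)`. -/
def Coh (A : Type*) [CommRing A] : Type _ := G.H1 →+ A

section

variable (A : Type*) [CommRing A]

instance : AddCommGroup (G.Coh A) := inferInstanceAs (AddCommGroup (G.H1 →+ A))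

instance : Module A (G.Coh A) := inferInstanceAs (Module A (G.H1 →+ A))

instance : FunLike (G.Coh A) G.H1 A := inferInstanceAs (FunLike (G.H1 →+ A) G.H1 A)

instance : AddMonoidHomClass (G.Coh A) G.H1 A :=
  inferInstanceAs (AddMonoidHomClass (G.H1 →+ A) G.H1 A)

end

section

variable {G} {A : Type*} [CommRing A]

@[ext] theorem N.ext {n n' : G.N} (h : ∀ γ, n γ = n' γ) : n = n' := DFunLike.ext _ _ h

@[simp] theorem N.add_apply (n n' : G.N) (γ : G.H1) : (n + n') γ = n γ + n' γ := rfl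

@[simp] theorem N.zero_apply (γ : G.H1) : (0 : G.N) γ = 0 := rfl

@[ext] theorem Coh.ext {u u' : G.Coh A} (h : ∀ γ, u γ = u' γ) : u = u' := DFunLike.ext _ _ h

@[simp] theorem Coh.add_apply (u u' : G.Coh A) (γ : G.H1) : (u + u') γ = u γ + u' γ := rfl

@[simp] theorem Coh.zero_apply (γ : G.H1) : (0 : G.Coh A) γ = 0 := rfl

@[simp] theorem Coh.smul_apply (c : A) (u : G.Coh A) (γ : G.H1) : (c • u) γ = c * u γ := rfl

@[simp] theorem Coh.sum_apply {ι : Type*} (s : Finset ι) (u : ι → G.Coh A) (γ : G.H1) :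
    (∑ i ∈ s, u i) γ = ∑ i ∈ s, u i γ :=
  AddMonoidHom.finsetSum_apply (M := G.H1) (N := A) u s γ

end

/-- The natural map `N → N_A`. -/
def toCoh (A : Type*) [CommRing A] : G.N →+ G.Coh A where
  toFun n := (Int.castAddHom A).comp n
  map_zero' := by ext γ; exact Int.cast_zero
  map_add' n n' := by ext γ; exact Int.cast_add _ _

@[simp] theorem toCoh_apply {A : Type*} [CommRing A] (n : G.N) (γ : G.H1) :
    G.toCoh A n γ = (n γ : A) := rfl

/-- The element of `N` sending a cycle to its coefficient at `e`.  It is `x_e⁻¹ π(e)`, see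
`smul_dir`. -/
def dir (e : E) : G.N := (Finsupp.applyAddHom e).comp G.H1.subtype.toAddMonoidHom

@[simp] theorem dir_apply (e : E) (γ : G.H1) : G.dir e γ = (γ : E →₀ ℤ) e := rfl

theorem exists_path (v w : V) :
    ∃ c : E →₀ ℤ, G.bdry c = Finsupp.single w (1 : ℤ) - Finsupp.single v 1 := by
  induction G.connected v w with
  | rel a b h =>
    obtain ⟨e, rfl, rfl⟩ := h
    exact ⟨Finsupp.single e 1, by simp [bdry]⟩
  | refl a => exact ⟨0, by simp⟩
  | symm a b _ ih => obtain ⟨c, hc⟩ := ih; exact ⟨-c, by simp [hc]⟩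
  | trans a b d _ _ ih ih' =>
    obtain ⟨c, hc⟩ := ih
    obtain ⟨c', hc'⟩ := ih'
    exact ⟨c + c', by rw [map_add, hc, hc']; abel⟩

/-- A path from `v` to `w`, as a 1-chain with boundary `w - v`.  Two such chains differ by an
element of `H₁(G, ℤ)`, hence their images under `π` differ by an element of `Λ`. -/
def path (v w : V) : E →₀ ℤ := (G.exists_path v w).choose

variable [Fintype E]

/-- The length pairing `C₁ × C₁ → A` with `[e, e] = x e` and `[e, e'] = 0` for `e ≠ e'`. -/
def pairing {A : Type*} [CommRing A] (x : E → A) :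
    (E →₀ ℤ) →ₗ[ℤ] (E →₀ ℤ) →ₗ[ℤ] A :=
  LinearMap.mk₂ ℤ (fun c d => ∑ e, (c e * d e) • x e)
    (fun c c' d => by simp [add_mul, add_smul, Finset.sum_add_distrib])
    (fun k c d => by simp [mul_smul, Finset.smul_sum, mul_assoc])
    (fun c d d' => by simp [mul_add, add_mul, Finset.sum_add_distrib])
    (fun k c d => by
      simp only [Finsupp.smul_apply, Finset.smul_sum, smul_smul, smul_eq_mul]
      exact Finset.sum_congr rfl fun e _ => by rw [mul_left_comm])

/-- `π : C₁(G, ℤ) → N_A`, `c ↦ [c, ·]`. -/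
def proj {A : Type*} [CommRing A] (x : E → A) : (E →₀ ℤ) →+ G.Coh A where
  toFun c := ((pairing x c).comp G.H1.subtype).toAddMonoidHom
  map_zero' := by rw [map_zero]; rfl
  map_add' c d := by rw [map_add]; rfl

@[simp] theorem proj_apply {A : Type*} [CommRing A] (x : E → A) (c : E →₀ ℤ) (γ : G.H1) :
    G.proj x c γ = pairing x c γ := rfl

/-- The lattice `Λ = π(H₁(G, ℤ)) ⊆ N_A`. -/
def lattice {A : Type*} [CommRing A] (x : E → A) : AddSubgroup (G.Coh A) :=
  G.H1.toAddSubgroup.map (G.proj x)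

theorem smul_dir {A : Type*} [CommRing A] (x : E → A) (e : E) :
    x e • G.toCoh A (G.dir e) = G.proj x (Finsupp.single e 1) := by
  classical
  ext γ
  simp only [Coh.smul_apply, toCoh_apply, dir_apply, proj_apply, pairing, LinearMap.mk₂_apply]
  rw [Finset.sum_eq_single e]
  · simp [mul_comm]
  · intro b _ hb
    simp [hb.symm]
  · simp

end MGraph

/-! ### Chain complexes from face maps -/

/-- The alternating sum of face maps on free abelian groups. -/
def altBdry {S T : Type*} {q : ℕ} (face : Fin (q + 2) → S → T) :
    FreeAbelianGroup S →+ FreeAbelianGroup T :=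
  ∑ i : Fin (q + 2), (-1 : ℤ) ^ (i : ℕ) • FreeAbelianGroup.map (face i)

/-! ### The universal Jacobian: ordered simplices modulo translation -/

section Ordered

variable {M : Type*} [AddCommGroup M] (L : AddSubgroup M)

/-- `(u₀ + l, …, u_q + l) ∼ (u₀, …, u_q)` for `l ∈ L`. -/
def ordSetoid (q : ℕ) : Setoid (Fin (q + 1) → M) where
  r u u' := ∃ l ∈ L, ∀ i, u' i = u i + l
  iseqv :=
    { refl := fun u => ⟨0, L.zero_mem, by simp⟩
      symm := by
        rintro u u' ⟨l, hl, h⟩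
        exact ⟨-l, L.neg_mem hl, fun i => by rw [h i]; abel⟩
      trans := by
        rintro u u' u'' ⟨l, hl, h⟩ ⟨l', hl', h'⟩
        exact ⟨l + l', L.add_mem hl hl', fun i => by rw [h' i, h i]; abel⟩ }

/-- Ordered `q`-simplices of `M / L`. -/
abbrev OrdSimplex (q : ℕ) : Type _ := Quotient (ordSetoid L q)

/-- The class of the ordered simplex `(u₀, …, u_q)`. -/
def ordMk {q : ℕ} (u : Fin (q + 1) → M) : OrdSimplex L q := Quotient.mk (ordSetoid L q) u

/-- Omitting the `i`-th vertex. -/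
def ordFace {q : ℕ} (i : Fin (q + 2)) : OrdSimplex L (q + 1) → OrdSimplex L q :=
  Quotient.map' (fun u j => u (i.succAbove j)) (by
    rintro u u' ⟨l, hl, h⟩
    exact ⟨l, hl, fun j => h _⟩)

/-- The inversion `(u₀, …, u_q) ↦ (-u₀, …, -u_q)`. -/
def ordNeg {q : ℕ} : OrdSimplex L q → OrdSimplex L q :=
  Quotient.map' (fun u j => -u j) (by
    rintro u u' ⟨l, hl, h⟩
    exact ⟨-l, L.neg_mem hl, fun j => by simp only [h j]; abel⟩)

end Ordered

namespace MGraph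

variable {V E : Type*} [Fintype E] (G : MGraph V E)

/-! ### The universal Ceresa period -/

section Universal

/-! The definitions of this section are used for the polynomial ring `A = ℤ[x_e | e ∈ E(G)]` with
its variables `x_e`, but they make sense for all rings `A` and elements `x_e` of `A`. -/

variable {A : Type*} [CommRing A] (x : E → A)

/-- The chains `C_{1,q}(Jac(G)) = N ⊗ C_q(Jac(G))`, where `C_q(Jac(G))` is the free abelian group
on the ordered `q`-simplices of `N_A` modulo translation by `Λ`. -/
abbrev UChain (q : ℕ) : Type _ := G.N ⊗[ℤ] FreeAbelianGroup (OrdSimplex (G.lattice x) q)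

/-- The boundary `C_{1,q+1}(Jac(G)) → C_{1,q}(Jac(G))`. -/
def uBdry (q : ℕ) : G.UChain x (q + 1) →+ G.UChain x q :=
  (LinearMap.lTensor G.N (altBdry (ordFace (G.lattice x))).toIntLinearMap).toAddMonoidHom

/-- The pushforward `[-1]_*` on `C_{1,q}(Jac(G))`. -/
def uNeg (q : ℕ) : G.UChain x q →+ G.UChain x q :=
  (TensorProduct.map (-LinearMap.id)
    (FreeAbelianGroup.map (ordNeg (G.lattice x))).toIntLinearMap).toAddMonoidHom

/-- `Φ_v(e) = x_e⁻¹ π(e) ⊗ (π(δ_e), π(δ_e + e))`, with `δ_e` a path from `v` to `e⁻`. -/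
def uPhi (v : V) (e : E) : G.UChain x 1 :=
  G.dir e ⊗ₜ[ℤ] FreeAbelianGroup.of
    (ordMk (G.lattice x)
      ![G.proj x (G.path v (G.tail e)),
        G.proj x (G.path v (G.tail e) + Finsupp.single e 1)])

/-- The universal Ceresa cycle `Cer_v(G)`. -/
def uCer (v : V) : G.UChain x 1 := ∑ e, G.uPhi x v e - G.uNeg x 1 (∑ e, G.uPhi x v e)

/-- `n ↦ n ∧ (u₁ - u₀) ∧ (u₂ - u₀)` on `N`, for an ordered 2-simplex of `N_A`. -/
def uThetaFun (u : Fin 3 → G.Coh A) : G.N →ₗ[ℤ] ⋀[A]^3 (G.Coh A) :=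
  AddMonoidHom.toIntLinearMap
    { toFun := fun n => wedge A (G.toCoh A n) (u 1 - u 0) (u 2 - u 0)
      map_zero' := by
        rw [map_zero]
        exact AlternatingMap.map_coord_zero _ (0 : Fin 3) rfl
      map_add' := fun n n' => by
        rw [map_add]
        exact MultilinearMap.cons_add _ _ _ _ }

/-- `Θ : C_{1,2}(Jac(G)) → N_A^{∧3}`, `n ⊗ (u₀, u₁, u₂) ↦ n ∧ (u₁ - u₀) ∧ (u₂ - u₀)`. -/
def uTheta : G.UChain x 2 →+ ⋀[A]^3 (G.Coh A) :=
  (TensorProduct.lift (LinearMap.flip (FreeAbelianGroup.lift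
    (fun s : OrdSimplex (G.lattice x) 2 => Quotient.liftOn s G.uThetaFun (by
      rintro u u' ⟨l, -, h⟩
      have h1 : u' 1 - u' 0 = u 1 - u 0 := by rw [h 1, h 0]; abel
      have h2 : u' 2 - u' 0 = u 2 - u 0 := by rw [h 2, h 0]; abel
      ext1 n
      simp [uThetaFun, h1, h2]))).toIntLinearMap)).toAddMonoidHom

/-- `𝒫 = Θ(H_{1,2}(Jac(G)))`, the values of `Θ` on the cycles of `C_{1,2}(Jac(G))`. -/
def uPeriods : AddSubgroup (⋀[A]^3 (G.Coh A)) :=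
  (G.uBdry x 1).ker.map (G.uTheta x)

/-- The universal Ceresa period `α(G) ∈ N_A^{∧3} / 𝒫`: the class of `Θ(Σ)` for any `Σ` with
`∂Σ = Cer_v(G)`. -/
def uAlpha (v : V) : ⋀[A]^3 (G.Coh A) ⧸ G.uPeriods x :=
  QuotientAddGroup.mk
    (G.uTheta x (Classical.epsilon fun S : G.UChain x 2 => G.uBdry x 1 S = G.uCer x v))

end Universal

/-! ### Smooth simplices in the tropical Jacobian -/

variable (l : E → ℝ)

/-- The tropical Jacobian `Jac(C) = N_ℝ / Λ_C` of the tropical curve with model `(G, l)`. -/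
abbrev Jac : Type _ := G.Coh ℝ ⧸ G.lattice l

/-- `f` is a smooth map into `N_ℝ` near the point `t ∈ ℝ^{q+1}` and lifts `s` on the part of the
standard simplex near `t`.  Smoothness into the finite-dimensional space
`N_ℝ = Hom(H₁(G, ℤ), ℝ)` is smoothness of all the coordinates `u ↦ u(γ)`. -/
def IsLocalLift {q : ℕ} (s : stdSimplex ℝ (Fin (q + 1)) → G.Jac l) (t : Fin (q + 1) → ℝ)
    (f : (Fin (q + 1) → ℝ) → G.Coh ℝ) : Prop :=
  ∃ U : Set (Fin (q + 1) → ℝ), IsOpen U ∧ t ∈ U ∧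
    (∀ γ : G.H1, ContDiffOn ℝ ∞ (fun y => f y γ) U) ∧
    ∀ y : stdSimplex ℝ (Fin (q + 1)), (y : Fin (q + 1) → ℝ) ∈ U →
      QuotientAddGroup.mk' (G.lattice l) (f y) = s y

/-- Smooth singular `q`-simplices `Δ^q → Jac(C)`.  The smooth structure of `Jac(C)` is the
quotient one, so that a map is smooth if and only if it locally lifts to a smooth map
into `N_ℝ`. -/
def SmoothSimplex (q : ℕ) : Type _ :=
  {s : stdSimplex ℝ (Fin (q + 1)) → G.Jac l // ∀ t : stdSimplex ℝ (Fin (q + 1)),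
    ∃ f, G.IsLocalLift l s t f}

/-- The `i`-th face of a smooth simplex: restriction to the face opposite to the `i`-th vertex. -/
def smFace {q : ℕ} (i : Fin (q + 2)) (s : G.SmoothSimplex l (q + 1)) : G.SmoothSimplex l q :=
  ⟨fun t => s.1 (stdSimplex.map i.succAbove t), fun t => by
    obtain ⟨f, U, hU, ht, hf, hs⟩ := s.2 (stdSimplex.map i.succAbove t)
    have hc : ContDiff ℝ ∞ (FunOnFinite.linearMap ℝ ℝ i.succAbove) :=
      (LinearMap.toContinuousLinearMap (FunOnFinite.linearMap ℝ ℝ i.succAbove)).contDiff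
    exact ⟨fun y => f (FunOnFinite.linearMap ℝ ℝ i.succAbove y),
      FunOnFinite.linearMap ℝ ℝ i.succAbove ⁻¹' U, hU.preimage hc.continuous, ht,
      fun γ => (hf γ).comp hc.contDiffOn (fun _ h => h),
      fun y hy => hs (stdSimplex.map i.succAbove y) hy⟩⟩

/-- The affine simplex `(u₀, …, u_q)` of `Jac(C)`. -/
def affine {q : ℕ} (u : Fin (q + 1) → G.Coh ℝ) : G.SmoothSimplex l q :=
  ⟨fun t => QuotientAddGroup.mk' (G.lattice l) (∑ i, t i • u i), fun t =>
    ⟨fun y => ∑ i, y i • u i, Set.univ, isOpen_univ, trivial, fun γ => by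
      simp only [Coh.sum_apply, Coh.smul_apply]
      fun_prop, fun y _ => rfl⟩⟩

/-- The smooth tropical chains `S_{1,q}(Jac(C)) = N ⊗ S_q(Jac(C))`. -/
abbrev SChain (q : ℕ) : Type _ := G.N ⊗[ℤ] FreeAbelianGroup (G.SmoothSimplex l q)

/-- The boundary `S_{1,q+1}(Jac(C)) → S_{1,q}(Jac(C))`. -/
def sBdry (q : ℕ) : G.SChain l (q + 1) →+ G.SChain l q :=
  (LinearMap.lTensor G.N (altBdry (G.smFace l)).toIntLinearMap).toAddMonoidHom

/-! ### The tropical Ceresa cycle -/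

/-- The points of the tropical curve with model `(G, l)`: vertices, and interior points of an
edge `e` at distance `t` from `e⁻`. -/
inductive Point {V E : Type*} (l : E → ℝ) : Type _
  | vertex (v : V) : Point l
  | inner (e : E) (t : ℝ) (h0 : 0 < t) (h1 : t < l e) : Point l

/-- The vertex from which the point `p` is reached along at most one partial edge. -/
def baseVertex : Point (V := V) l → V
  | .vertex v => v
  | .inner e _ _ _ => G.tail e

/-- The image under `π` of the partial edge from `baseVertex p` to `p`. -/
def offset : Point (V := V) l → G.Coh ℝ
  | .vertex _ => 0
  | .inner e t _ _ => t • G.toCoh ℝ (G.dir e)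

open Classical in
/-- The coarsest refinement of `(G, l)` having `p` as a vertex: the edge `e ≅ [0, l e]` is replaced
by the listed subintervals. -/
def segments (p : Point (V := V) l) (e : E) : List (ℝ × ℝ) :=
  match p with
  | .vertex _ => [(0, l e)]
  | .inner e' t _ _ => if e = e' then [(0, t), (t, l e)] else [(0, l e)]

/-- A lift to `N_ℝ` of the image under the Abel--Jacobi map based at `p` of the point
of the edge `e` at distance `a` from `e⁻`, namely `π(δ)` for a path `δ` from `p` to that point. -/
def abelJacobi (p : Point (V := V) l) (e : E) (a : ℝ) : G.Coh ℝ :=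
  G.proj l (G.path (G.baseVertex l p) (G.tail e)) - G.offset l p + a • G.toCoh ℝ (G.dir e)

/-- The tropical Ceresa cycle `Cer_p(C)`: the sum over the edges `e` of a model having `p` as a
vertex of `l(e)⁻¹ π(e) ⊗ ((π(δ_e), π(δ_e + e)) + (-π(δ_e), -π(δ_e + e)))`, where `δ_e` is a path
from `p` to `e⁻`. -/
def sCer (p : Point (V := V) l) : G.SChain l 1 :=
  ∑ e, ((segments l p e).map fun s => G.dir e ⊗ₜ[ℤ]
    (FreeAbelianGroup.of (G.affine l ![G.abelJacobi l p e s.1, G.abelJacobi l p e s.2]) +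
      FreeAbelianGroup.of
        (G.affine l ![-G.abelJacobi l p e s.1, -G.abelJacobi l p e s.2]))).sum

/-! ### Integration and the Ceresa period of a tropical curve -/

/-- A smooth lift of `s` to `N_ℝ` near `t`.  It is unique on the simplex up to a translation by
`Λ_C`, hence its derivatives along the simplex do not depend on the choice. -/
def localLift {q : ℕ} (s : G.SmoothSimplex l q) (t : Fin (q + 1) → ℝ) :
    (Fin (q + 1) → ℝ) → G.Coh ℝ :=
  Classical.epsilon (G.IsLocalLift l s.1 t)

/-- The partial derivative `∂ z_γ / ∂ t_k` at `t` of a smooth simplex, where `z_γ(u) = u(γ)` and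
`t₁, …, t_q` are used as coordinates on `Δ^q` (so that `t₀ = 1 - t₁ - ⋯ - t_q`). -/
def partialD {q : ℕ} (s : G.SmoothSimplex l q) (γ : G.H1) (k : Fin (q + 1))
    (t : Fin (q + 1) → ℝ) : ℝ :=
  fderiv ℝ (fun y => G.localLift l s t y γ) t (Pi.single k 1 - Pi.single 0 1)

/-- `∫_s dz_γ ∧ dz_γ'` for a smooth 2-simplex `s`. -/
def integral2 (s : G.SmoothSimplex l 2) (γ γ' : G.H1) : ℝ :=
  ∫ y in {y : ℝ × ℝ | 0 ≤ y.1 ∧ 0 ≤ y.2 ∧ y.1 + y.2 ≤ 1},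
    (G.partialD l s γ 1 ![1 - y.1 - y.2, y.1, y.2] *
        G.partialD l s γ' 2 ![1 - y.1 - y.2, y.1, y.2] -
      G.partialD l s γ 2 ![1 - y.1 - y.2, y.1, y.2] *
        G.partialD l s γ' 1 ![1 - y.1 - y.2, y.1, y.2])

variable {g : ℕ} (b : Module.Basis (Fin g) ℤ G.H1)

/-- The basis element `ε_i` of `N`, viewed in `N_ℝ`, where `ε` is dual to the basis `b` of
`H₁(G, ℤ)`. -/
def eps (i : Fin g) : G.Coh ℝ := G.toCoh ℝ ((b.coord i).toAddMonoidHom : G.H1 →+ ℤ)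

/-- `n ↦ 2 ∑_{i<j<k} (∫_s n_i dz_j ∧ dz_k - n_j dz_i ∧ dz_k + n_k dz_i ∧ dz_j) ε_i ∧ ε_j ∧ ε_k`.
The coordinates on `N_ℝ` with respect to `ε` are `z_i(u) = u(b i)`. -/
def sThetaFun (s : G.SmoothSimplex l 2) : G.N →ₗ[ℤ] ⋀[ℝ]^3 (G.Coh ℝ) :=
  AddMonoidHom.toIntLinearMap
    { toFun := fun n =>
        ∑ I : Fin g × Fin g × Fin g with I.1 < I.2.1 ∧ I.2.1 < I.2.2,
          (2 * ((n (b I.1) : ℝ) * G.integral2 l s (b I.2.1) (b I.2.2)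
            - (n (b I.2.1) : ℝ) * G.integral2 l s (b I.1) (b I.2.2)
            + (n (b I.2.2) : ℝ) * G.integral2 l s (b I.1) (b I.2.1))) •
          wedge ℝ (G.eps b I.1) (G.eps b I.2.1) (G.eps b I.2.2)
      map_zero' := by simp
      map_add' := fun n n' => by
        rw [← Finset.sum_add_distrib]
        refine Finset.sum_congr rfl fun I _ => ?_
        rw [← add_smul]
        congr 1
        simp only [N.add_apply, Int.cast_add]
        ring }

/-- The integration map `Θ_C : S_{1,2}(Jac(C)) → N_ℝ^{∧3}`. -/
def sTheta : G.SChain l 2 →+ ⋀[ℝ]^3 (G.Coh ℝ) :=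
  (TensorProduct.lift
    (LinearMap.flip (FreeAbelianGroup.lift (G.sThetaFun l b)).toIntLinearMap)).toAddMonoidHom

/-- `𝒫_C = Θ_C(H_{1,2}(Jac(C)))`, the values of `Θ_C` on the cycles of `S_{1,2}(Jac(C))`. -/
def sPeriods : AddSubgroup (⋀[ℝ]^3 (G.Coh ℝ)) :=
  (G.sBdry l 1).ker.map (G.sTheta l b)

/-- The Ceresa period `α(C) ∈ N_ℝ^{∧3} / 𝒫_C`: the class of `Θ_C(Σ)` for any `Σ` with
`∂Σ = Cer_p(C)`. -/
def sAlpha (p : Point (V := V) l) : ⋀[ℝ]^3 (G.Coh ℝ) ⧸ G.sPeriods l b :=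
  QuotientAddGroup.mk
    (G.sTheta l b (Classical.epsilon fun S : G.SChain l 2 => G.sBdry l 1 S = G.sCer l p))

/-! ### Evaluation -/

/-- The ring map `ev : R = ℤ[x_e | e ∈ E(G)] → ℝ`, `x_e ↦ l(e)`. -/
def evRing {E : Type*} (l : E → ℝ) : MvPolynomial E ℤ →+* ℝ :=
  MvPolynomial.eval₂Hom (Int.castRingHom ℝ) l

/-- The variables `x_e` of `R`. -/
abbrev vars (E : Type*) : E → MvPolynomial E ℤ := MvPolynomial.X

/-- The induced map `N_R → N_ℝ`. -/
def evCoh : G.Coh (MvPolynomial E ℤ) →ₛₗ[evRing l] G.Coh ℝ where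
  toFun u := (evRing l).toAddMonoidHom.comp u
  map_add' u u' := by ext γ; exact map_add (evRing l) _ _
  map_smul' c u := by ext γ; exact map_mul (evRing l) _ _

/-- The induced map `N_R^{∧3} → N_ℝ^{∧3}`. -/
def evExt : ⋀[MvPolynomial E ℤ]^3 (G.Coh (MvPolynomial E ℤ)) →+ ⋀[ℝ]^3 (G.Coh ℝ) :=
  (extMap (evRing l) 3 (G.evCoh l)).toAddMonoidHom

end MGraph

end Ceresa

end

/-!
Straightening a smooth simplex to the affine one on the vertices of a lift changes `Θ_C` only by a
functional of the boundary, by Stokes' theorem, and this functional vanishes on affine edges. Hence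
`𝒫_C` is the group of periods of *ordered* chains with real coefficients. As `ℓ > 0`, the map `π_C`
is injective on `H₁`, so there is a map `N_ℝ → N_R` that is equivariant along `Λ_C ≅ Λ`. It lifts
ordered real chains to universal ones, and after evaluation it alters the area of a triangle only by
a coboundary; this gives `ev 𝒫 = 𝒫_C` and the compatibility of the two Ceresa periods.

`Cer_v` is a boundary because, modulo boundaries, `(u₀, u₁) + (-u₀, -u₁)` is `f u₁ - f u₀` for a
`Λ`-invariant potential `f`, so that `Cer_v` is the pairing of `f` with `∑ nₑ ⊗ ∂e`, which vanishes
on `H₁`. Moving the base point, or subdividing an edge, changes `Cer` by the boundary of prisms and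
triangles all of whose edges are parallel to `nₑ` up to translation, and `Θ` does not see those.
-/

open scoped TensorProduct ContDiff

noncomputable section

namespace Ceresa

/-! ### Chains with coefficients in an abelian group -/

section Chains

variable {N X S T S' T' : Type*} [AddCommGroup N] [AddCommGroup X]

theorem tensorFree_hom_ext {f f' : N ⊗[ℤ] FreeAbelianGroup S →+ X}
    (h : ∀ n s, f (n ⊗ₜ FreeAbelianGroup.of s) = f' (n ⊗ₜ FreeAbelianGroup.of s)) : f = f' := by
  have on_free (n : N) : f.comp (TensorProduct.mk ℤ N _ n).toAddMonoidHom =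
      f'.comp (TensorProduct.mk ℤ N _ n).toAddMonoidHom := FreeAbelianGroup.lift_ext _ _ (h n)
  ext c
  induction c with
  | zero => simp only [map_zero]
  | add a b ha hb => simp only [map_add, ha, hb]
  | tmul n s => exact DFunLike.congr_fun (on_free n) s

/-- The homomorphism `N ⊗ ℤ[S] → N ⊗ ℤ[T]` induced by a map `S → T`. -/
def pushChain (N : Type*) [AddCommGroup N] (f : S → T) :
    N ⊗[ℤ] FreeAbelianGroup S →+ N ⊗[ℤ] FreeAbelianGroup T :=
  (LinearMap.lTensor N (FreeAbelianGroup.map f).toIntLinearMap).toAddMonoidHom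

/-- The alternating sum of face maps with coefficients in `N`. -/
def bdryChain (N : Type*) [AddCommGroup N] {q : ℕ} (face : Fin (q + 2) → S → T) :
    N ⊗[ℤ] FreeAbelianGroup S →+ N ⊗[ℤ] FreeAbelianGroup T :=
  (LinearMap.lTensor N (altBdry face).toIntLinearMap).toAddMonoidHom

/-- The homomorphism `N ⊗ ℤ[S] → X` given by a family of homomorphisms `N → X`. -/
def evalChain (f : S → N →ₗ[ℤ] X) : N ⊗[ℤ] FreeAbelianGroup S →+ X :=
  (TensorProduct.lift (LinearMap.flip (FreeAbelianGroup.lift f).toIntLinearMap)).toAddMonoidHom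

@[simp] theorem pushChain_tmul (f : S → T) (n : N) (s : FreeAbelianGroup S) :
    pushChain N f (n ⊗ₜ s) = n ⊗ₜ FreeAbelianGroup.map f s := rfl

@[simp] theorem bdryChain_tmul {q : ℕ} (face : Fin (q + 2) → S → T) (n : N)
    (s : FreeAbelianGroup S) : bdryChain N face (n ⊗ₜ s) = n ⊗ₜ altBdry face s := rfl

@[simp] theorem evalChain_tmul (f : S → N →ₗ[ℤ] X) (n : N) (s : FreeAbelianGroup S) :
    evalChain f (n ⊗ₜ s) = FreeAbelianGroup.lift f s n := rfl

theorem evalChain_tmul_of (f : S → N →ₗ[ℤ] X) (n : N) (s : S) :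
    evalChain f (n ⊗ₜ FreeAbelianGroup.of s) = f s n := by simp

@[simp] theorem altBdry_of {q : ℕ} (face : Fin (q + 2) → S → T) (s : S) :
    altBdry face (FreeAbelianGroup.of s) =
      ∑ i : Fin (q + 2), (-1 : ℤ) ^ (i : ℕ) • FreeAbelianGroup.of (face i s) := by
  simp [altBdry, AddMonoidHom.finsetSum_apply]

theorem pushChain_pushChain {U : Type*} (f : S → T) (g : T → U)
    (c : N ⊗[ℤ] FreeAbelianGroup S) :
    pushChain N g (pushChain N f c) = pushChain N (fun s => g (f s)) c := by
  have : (pushChain N g).comp (pushChain N f) = pushChain N (fun s => g (f s)) :=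
    tensorFree_hom_ext fun n s => by simp
  exact DFunLike.congr_fun this c

theorem pushChain_eq_self {f : S → S} (h : ∀ s, f s = s) (c : N ⊗[ℤ] FreeAbelianGroup S) :
    pushChain N f c = c := by
  have : pushChain N f = AddMonoidHom.id _ := tensorFree_hom_ext fun n s => by simp [h]
  exact DFunLike.congr_fun this c

theorem bdryChain_pushChain {q : ℕ} {face : Fin (q + 2) → S → T} {face' : Fin (q + 2) → S' → T'}
    {f : S → S'} {f' : T → T'} (h : ∀ i s, face' i (f s) = f' (face i s))
    (c : N ⊗[ℤ] FreeAbelianGroup S) :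
    bdryChain N face' (pushChain N f c) = pushChain N f' (bdryChain N face c) := by
  have : (bdryChain N face').comp (pushChain N f) = (pushChain N f').comp (bdryChain N face) :=
    tensorFree_hom_ext fun n s => by simp [h, TensorProduct.tmul_sum]
  exact DFunLike.congr_fun this c

theorem evalChain_pushChain (f : S → T) (θ : T → N →ₗ[ℤ] X) (c : N ⊗[ℤ] FreeAbelianGroup S) :
    evalChain θ (pushChain N f c) = evalChain (fun s => θ (f s)) c := by
  have : (evalChain θ).comp (pushChain N f) = evalChain (fun s => θ (f s)) :=
    tensorFree_hom_ext fun n s => by simp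
  exact DFunLike.congr_fun this c

theorem evalChain_add_coboundary {q : ℕ} {face : Fin (q + 2) → S → T} {θ θ' : S → N →ₗ[ℤ] X}
    (h : T → N →ₗ[ℤ] X)
    (H : ∀ s n, θ' s n = θ s n + ∑ i : Fin (q + 2), (-1 : ℤ) ^ (i : ℕ) • h (face i s) n)
    (c : N ⊗[ℤ] FreeAbelianGroup S) :
    evalChain θ' c = evalChain θ c + evalChain h (bdryChain N face c) := by
  have : evalChain θ' = evalChain θ + (evalChain h).comp (bdryChain N face) := by
    refine tensorFree_hom_ext fun n s => ?_
    simp [H, TensorProduct.tmul_sum]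
  exact DFunLike.congr_fun this c

theorem map_evalChain {Y : Type*} [AddCommGroup Y] (φ : X →+ Y) (θ : S → N →ₗ[ℤ] X)
    (θ' : S → N →ₗ[ℤ] Y) (h : ∀ s n, φ (θ s n) = θ' s n) (c : N ⊗[ℤ] FreeAbelianGroup S) :
    φ (evalChain θ c) = evalChain θ' c := by
  have : φ.comp (evalChain θ) = evalChain θ' := tensorFree_hom_ext fun n s => by simp [h]
  exact DFunLike.congr_fun this c

theorem exists_bdryChain_eq {q : ℕ} (face : Fin (q + 2) → S → T) (c : N ⊗[ℤ] FreeAbelianGroup T)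
    (hc : LinearMap.lTensor N
      (QuotientAddGroup.mk' (altBdry face).range).toIntLinearMap c = 0) :
    ∃ d, bdryChain N face d = c := by
  have hex : Function.Exact (altBdry face).toIntLinearMap
      (QuotientAddGroup.mk' (altBdry face).range).toIntLinearMap := fun y => by simp
  exact (lTensor_exact N hex (QuotientAddGroup.mk'_surjective _) c).mp hc

end Chains

/-! ### Ordered simplices modulo translation -/

theorem face_zero_edge {M : Type*} (u v w : M) :
    (fun j => ![u, v, w] ((0 : Fin 3).succAbove j)) = ![v, w] := by
  ext j; fin_cases j <;> rfl

theorem face_one_edge {M : Type*} (u v w : M) :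
    (fun j => ![u, v, w] ((1 : Fin 3).succAbove j)) = ![u, w] := by
  ext j; fin_cases j <;> rfl

theorem face_two_edge {M : Type*} (u v w : M) :
    (fun j => ![u, v, w] ((2 : Fin 3).succAbove j)) = ![u, v] := by
  ext j; fin_cases j <;> rfl

section Ordered

variable {M M' : Type*} [AddCommGroup M] [AddCommGroup M'] {L : AddSubgroup M}
  {L' : AddSubgroup M'}

theorem ordMk_eq_ordMk {q : ℕ} {u u' : Fin (q + 1) → M} {a : M} (ha : a ∈ L)
    (h : ∀ i, u' i = u i + a) : ordMk L u = ordMk L u' :=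
  Quotient.sound ⟨a, ha, h⟩

theorem ordMk_edge_add_right {a : M} (ha : a ∈ L) (u v : M) :
    ordMk L ![u + a, v + a] = ordMk L ![u, v] :=
  (ordMk_eq_ordMk ha fun i => by fin_cases i <;> rfl).symm

@[simp] theorem ordFace_ordMk {q : ℕ} (i : Fin (q + 2)) (u : Fin (q + 2) → M) :
    ordFace L i (ordMk L u) = ordMk L (fun j => u (i.succAbove j)) := rfl

@[simp] theorem ordNeg_ordMk {q : ℕ} (u : Fin (q + 1) → M) :
    ordNeg L (ordMk L u) = ordMk L (fun j => -u j) := rfl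

theorem ordNeg_edge (u v : M) : ordNeg L (ordMk L ![u, v]) = ordMk L ![-u, -v] := by
  rw [ordNeg_ordMk]
  congr 1
  ext i : 1
  fin_cases i <;> rfl

/-- The map of ordered simplices induced by a map that is equivariant modulo the lattices. -/
def ordMap (f : M → M') (hf : ∀ a ∈ L, ∃ a' ∈ L', ∀ u, f (u + a) = f u + a') {q : ℕ} :
    OrdSimplex L q → OrdSimplex L' q :=
  Quotient.map' (fun u j => f (u j)) (by
    rintro u u' ⟨a, ha, h⟩
    obtain ⟨a', ha', h'⟩ := hf a ha
    exact ⟨a', ha', fun i => by simp only [h i, h']⟩)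

@[simp] theorem ordMap_ordMk (f : M → M') (hf : ∀ a ∈ L, ∃ a' ∈ L', ∀ u, f (u + a) = f u + a')
    {q : ℕ} (u : Fin (q + 1) → M) : ordMap f hf (ordMk L u) = ordMk L' (fun j => f (u j)) := rfl

theorem ordMap_edge (f : M → M') (hf : ∀ a ∈ L, ∃ a' ∈ L', ∀ u, f (u + a) = f u + a') (u v : M) :
    ordMap f hf (ordMk L ![u, v]) = ordMk L' ![f u, f v] := by
  rw [ordMap_ordMk]
  congr 1
  ext i : 1
  fin_cases i <;> rfl

theorem ordMap_ordMap {M'' : Type*} [AddCommGroup M''] {L'' : AddSubgroup M''} (f : M → M')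
    (hf : ∀ a ∈ L, ∃ a' ∈ L', ∀ u, f (u + a) = f u + a') (g : M' → M'')
    (hg : ∀ a ∈ L', ∃ a' ∈ L'', ∀ u, g (u + a) = g u + a')
    (hgf : ∀ a ∈ L, ∃ a' ∈ L'', ∀ u, g (f (u + a)) = g (f u) + a') {q : ℕ} (s : OrdSimplex L q) :
    ordMap g hg (ordMap f hf s) = ordMap (fun u => g (f u)) hgf s := by
  induction s using Quotient.inductionOn with
  | h u => rfl

theorem ordFace_ordMap (f : M → M') (hf : ∀ a ∈ L, ∃ a' ∈ L', ∀ u, f (u + a) = f u + a') {q : ℕ}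
    (i : Fin (q + 2)) (s : OrdSimplex L (q + 1)) :
    ordFace L' i (ordMap f hf s) = ordMap f hf (ordFace L i s) := by
  induction s using Quotient.inductionOn with
  | h u => rfl

theorem altBdry_triangle (L : AddSubgroup M) (u v w : M) :
    altBdry (ordFace L) (FreeAbelianGroup.of (ordMk L ![u, v, w])) =
      FreeAbelianGroup.of (ordMk L ![v, w]) - FreeAbelianGroup.of (ordMk L ![u, w]) +
        FreeAbelianGroup.of (ordMk L ![u, v]) := by
  rw [altBdry_of, Fin.sum_univ_three, ordFace_ordMk, ordFace_ordMk, ordFace_ordMk,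
    face_zero_edge, face_one_edge, face_two_edge]
  simp [sub_eq_add_neg]

/-- `ℤ`-combinations of ordered edges of `M / L` modulo boundaries: the group in which one tests
whether a chain of edges, with arbitrary coefficients, is a boundary. -/
abbrev EdgeClass (L : AddSubgroup M) : Type _ :=
  FreeAbelianGroup (OrdSimplex L 1) ⧸ (altBdry (q := 1) (ordFace L)).range

/-- The class modulo boundaries of the ordered edge `(u, v)`. -/
def edgeClass (L : AddSubgroup M) (u v : M) : EdgeClass L :=
  QuotientAddGroup.mk' _ (FreeAbelianGroup.of (ordMk L ![u, v]))

theorem edgeClass_cocycle (u v w : M) :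
    edgeClass L v w - edgeClass L u w + edgeClass L u v = 0 := by
  simp only [edgeClass, ← map_sub, ← map_add, ← altBdry_triangle]
  exact (QuotientAddGroup.eq_zero_iff _).mpr ⟨_, rfl⟩

theorem edgeClass_add_right {a : M} (ha : a ∈ L) (u v : M) :
    edgeClass L (u + a) (v + a) = edgeClass L u v := by
  rw [edgeClass, ordMk_edge_add_right ha, edgeClass]

theorem edgeClass_eq_sub (u v : M) :
    edgeClass L u v = edgeClass L 0 v - edgeClass L 0 u := by
  rw [← sub_eq_zero, ← edgeClass_cocycle (L := L) 0 u v]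
  abel

theorem edgeClass_zero_zero : edgeClass L 0 0 = 0 := by
  simpa using edgeClass_cocycle (L := L) 0 0 0

theorem edgeClass_zero_add {a : M} (ha : a ∈ L) (u : M) :
    edgeClass L 0 (u + a) = edgeClass L 0 u + edgeClass L 0 a := by
  have h := edgeClass_add_right ha 0 u
  rw [zero_add, edgeClass_eq_sub] at h
  rw [← h, sub_add_cancel]

/-- The symmetrized edge `(u, v) + (-u, -v)`, the building block of the Ceresa cycles. -/
def symEdge (L : AddSubgroup M) (u v : M) : FreeAbelianGroup (OrdSimplex L 1) :=
  FreeAbelianGroup.of (ordMk L ![u, v]) + FreeAbelianGroup.of (ordMk L ![-u, -v])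

theorem symEdge_add_right {a : M} (ha : a ∈ L) (u v : M) :
    symEdge L (u + a) (v + a) = symEdge L u v := by
  rw [symEdge, symEdge, ordMk_edge_add_right ha, neg_add, neg_add,
    ordMk_edge_add_right (neg_mem ha)]

theorem map_ordMap_symEdge (f : M → M') (hf : ∀ a ∈ L, ∃ a' ∈ L', ∀ u, f (u + a) = f u + a')
    (hneg : ∀ u, f (-u) = -f u) (u v : M) :
    FreeAbelianGroup.map (ordMap f hf) (symEdge L u v) = symEdge L' (f u) (f v) := by
  simp only [symEdge, map_add, FreeAbelianGroup.map_of_apply, ordMap_edge, hneg]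

theorem altBdry_symTriangle (L : AddSubgroup M) (u v w : M) :
    altBdry (ordFace L) (FreeAbelianGroup.of (ordMk L ![u, v, w]) +
        FreeAbelianGroup.of (ordMk L ![-u, -v, -w])) =
      symEdge L v w - symEdge L u w + symEdge L u v := by
  rw [map_add, altBdry_triangle, altBdry_triangle, symEdge, symEdge, symEdge]
  abel

/-- The class of a symmetrized edge is a difference of values of this function, which descends to
`M / L`. -/
def symPotential (L : AddSubgroup M) (u : M) : EdgeClass L :=
  edgeClass L 0 u + edgeClass L 0 (-u)

theorem mk_symEdge (u v : M) :
    QuotientAddGroup.mk' (altBdry (q := 1) (ordFace L)).range (symEdge L u v) =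
      symPotential L v - symPotential L u := by
  rw [symEdge, map_add, ← edgeClass, ← edgeClass, edgeClass_eq_sub u, edgeClass_eq_sub (-u),
    symPotential, symPotential]
  abel

theorem symPotential_add {a : M} (ha : a ∈ L) (u : M) :
    symPotential L (u + a) = symPotential L u := by
  have hcancel : edgeClass L 0 (-a) = -edgeClass L 0 a := by
    rw [eq_neg_iff_add_eq_zero, ← edgeClass_zero_add ha, neg_add_cancel, edgeClass_zero_zero]
  rw [symPotential, neg_add, edgeClass_zero_add ha, edgeClass_zero_add (L.neg_mem ha), hcancel,
    symPotential]
  abel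

end Ordered

/-! ### The third exterior power -/

section Wedge

variable {A : Type*} [CommRing A] {M : Type*} [AddCommGroup M] [Module A M]

theorem wedge_add_left (a a' b c : M) :
    wedge A (a + a') b c = wedge A a b c + wedge A a' b c :=
  MultilinearMap.cons_add (exteriorPower.ιMulti A 3 (M := M)).toMultilinearMap ![b, c] a a'

theorem wedge_smul_left (r : A) (a b c : M) : wedge A (r • a) b c = r • wedge A a b c :=
  MultilinearMap.cons_smul (exteriorPower.ιMulti A 3 (M := M)).toMultilinearMap ![b, c] r a

theorem wedge_swap_left (a b c : M) : wedge A a b c = -wedge A b a c := by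
  have h := (exteriorPower.ιMulti A 3 (M := M)).map_swap ![b, a, c]
    (i := 0) (j := 1) (by decide)
  rw [wedge, wedge, ← h]
  congr 1
  ext i; fin_cases i <;> rfl

theorem wedge_swap_right (a b c : M) : wedge A a b c = -wedge A a c b := by
  have h := (exteriorPower.ιMulti A 3 (M := M)).map_swap ![a, c, b]
    (i := 1) (j := 2) (by decide)
  rw [wedge, wedge, ← h]
  congr 1
  ext i; fin_cases i <;> rfl

@[simp] theorem wedge_self_left (a b : M) : wedge A a a b = 0 :=
  (exteriorPower.ιMulti A 3 (M := M)).map_eq_zero_of_eq ![a, a, b] (i := 0) (j := 1) rfl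
    (by decide)

@[simp] theorem wedge_self_right (a b : M) : wedge A a b b = 0 :=
  (exteriorPower.ιMulti A 3 (M := M)).map_eq_zero_of_eq ![a, b, b] (i := 1) (j := 2) rfl
    (by decide)

theorem wedge_add_mid (a b b' c : M) :
    wedge A a (b + b') c = wedge A a b c + wedge A a b' c := by
  rw [wedge_swap_left, wedge_add_left, neg_add, ← wedge_swap_left, ← wedge_swap_left]

theorem wedge_smul_mid (r : A) (a b c : M) : wedge A a (r • b) c = r • wedge A a b c := by
  rw [wedge_swap_left, wedge_smul_left, wedge_swap_left a b c]
  exact (smul_neg r _).symm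

theorem wedge_add_right (a b c c' : M) :
    wedge A a b (c + c') = wedge A a b c + wedge A a b c' := by
  rw [wedge_swap_right, wedge_add_mid, neg_add, ← wedge_swap_right, ← wedge_swap_right]

theorem wedge_smul_right (r : A) (a b c : M) : wedge A a b (r • c) = r • wedge A a b c := by
  rw [wedge_swap_right, wedge_smul_mid, wedge_swap_right a b c]
  exact (smul_neg r _).symm

theorem wedge_neg_mid (a b c : M) : wedge A a (-b) c = -wedge A a b c := by
  rw [← neg_one_smul A b, wedge_smul_mid]
  exact neg_one_smul A (wedge A a b c)

theorem wedge_neg_right (a b c : M) : wedge A a b (-c) = -wedge A a b c := by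
  rw [← neg_one_smul A c, wedge_smul_right]
  exact neg_one_smul A (wedge A a b c)

theorem wedge_sub_mid (a b b' c : M) :
    wedge A a (b - b') c = wedge A a b c - wedge A a b' c := by
  rw [sub_eq_add_neg, wedge_add_mid, wedge_neg_mid, sub_eq_add_neg]

theorem wedge_sub_right (a b c c' : M) :
    wedge A a b (c - c') = wedge A a b c - wedge A a b c' := by
  rw [sub_eq_add_neg, wedge_add_right, wedge_neg_right, sub_eq_add_neg]

@[simp] theorem wedge_zero_left (a c : M) : wedge A 0 a c = 0 := by
  simpa using wedge_smul_left (0 : A) 0 a c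

/-- Moving the vertices of a triangle by `k₀, k₁, k₂` changes its area by a coboundary. -/
theorem wedge_move_vertices (n u₀ u₁ u₂ k₀ k₁ k₂ : M) :
    wedge A n ((u₁ + k₁) - (u₀ + k₀)) ((u₂ + k₂) - (u₀ + k₀)) =
      wedge A n (u₁ - u₀) (u₂ - u₀) +
        ((wedge A n k₁ k₂ - wedge A n (u₂ - u₁) (k₁ + k₂)) -
          (wedge A n k₀ k₂ - wedge A n (u₂ - u₀) (k₀ + k₂)) +
          (wedge A n k₀ k₁ - wedge A n (u₁ - u₀) (k₀ + k₁))) := by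
  simp only [wedge_add_mid, wedge_add_right, wedge_sub_mid, wedge_sub_right, wedge_self_right]
  rw [wedge_swap_right n k₁ u₂, wedge_swap_right n k₁ u₀, wedge_swap_right n k₀ u₂,
    wedge_swap_right n k₁ k₀, wedge_swap_right n k₀ u₀]
  abel

end Wedge

namespace MGraph

variable {V E : Type*} (G : MGraph V E)

/-! ### The cocycle condition and the symmetrized image of a graph -/

section Basic

variable {G}

theorem N.sum_apply {ι : Type*} (s : Finset ι) (n : ι → G.N) (γ : G.H1) :
    (∑ i ∈ s, n i) γ = ∑ i ∈ s, n i γ :=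
  AddMonoidHom.finsetSum_apply (M := G.H1) (N := ℤ) n s γ

theorem N.sub_apply (n n' : G.N) (γ : G.H1) : (n - n') γ = n γ - n' γ := rfl

@[simp] theorem Coh.sub_apply {A : Type*} [CommRing A] (u u' : G.Coh A) (γ : G.H1) :
    (u - u') γ = u γ - u' γ := rfl

end Basic

theorem bdry_single (e : E) : G.bdry (Finsupp.single e 1) =
    Finsupp.single (G.head e) 1 - Finsupp.single (G.tail e) 1 := by
  simp [bdry]

theorem bdry_path (v w : V) :
    G.bdry (G.path v w) = Finsupp.single w 1 - Finsupp.single v 1 :=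
  (G.exists_path v w).choose_spec

variable [Fintype E]

theorem sum_single_dir :
    ∑ e, (Finsupp.single (G.head e) (G.dir e) - Finsupp.single (G.tail e) (G.dir e)) =
      (0 : V →₀ G.N) := by
  classical
  ext w γ
  have hγ : G.bdry γ w = 0 := by rw [LinearMap.mem_ker.mp γ.2, Finsupp.zero_apply]
  rw [bdry, Finsupp.linearCombination_apply, Finsupp.sum_fintype _ _ (by simp),
    Finsupp.finsetSum_apply] at hγ
  rw [Finsupp.finsetSum_apply, N.sum_apply, Finsupp.zero_apply, N.zero_apply, ← hγ]
  refine Finset.sum_congr rfl fun e _ => ?_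
  have hsingle (v : V) : Finsupp.single v (G.dir e) w γ =
      (γ : E →₀ ℤ) e * Finsupp.single v (1 : ℤ) w := by
    rw [Finsupp.single_apply, Finsupp.single_apply]
    split_ifs <;> simp
  rw [Finsupp.sub_apply, N.sub_apply, hsingle, hsingle, Finsupp.smul_apply, Finsupp.sub_apply,
    smul_eq_mul, mul_sub]

theorem sum_dir_tmul_sub {X : Type*} [AddCommGroup X] (f : V → X) :
    ∑ e, G.dir e ⊗ₜ[ℤ] (f (G.head e) - f (G.tail e)) = 0 := by
  have h := congrArg (Finsupp.liftAddHom fun v =>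
    ((TensorProduct.mk ℤ G.N X).flip (f v)).toAddMonoidHom) G.sum_single_dir
  rw [map_sum, map_zero] at h
  rw [← h]
  refine Finset.sum_congr rfl fun e _ => ?_
  rw [map_sub, Finsupp.liftAddHom_apply_single, Finsupp.liftAddHom_apply_single,
    TensorProduct.tmul_sub]
  rfl

variable {A : Type*} [CommRing A] (x : E → A)

theorem proj_mem_lattice {c : E →₀ ℤ} (hc : G.bdry c = 0) : G.proj x c ∈ G.lattice x :=
  ⟨c, hc, rfl⟩

theorem proj_sub_proj_mem_lattice {c d : E →₀ ℤ} (h : G.bdry c = G.bdry d) :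
    G.proj x c - G.proj x d ∈ G.lattice x := by
  rw [← map_sub]
  exact G.proj_mem_lattice x (by rw [map_sub, h, sub_self])

theorem uBdry_eq_bdryChain (q : ℕ) : G.uBdry x q = bdryChain G.N (ordFace (G.lattice x)) := rfl

/-- The functional `n ↦ n ∧ (u₁ - u₀) ∧ (u₂ - u₀)` of an ordered `2`-simplex modulo `Λ`. -/
def ordArea (s : OrdSimplex (G.lattice x) 2) : G.N →ₗ[ℤ] ⋀[A]^3 (G.Coh A) :=
  Quotient.liftOn s G.uThetaFun (by
      rintro u u' ⟨l, -, h⟩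
      have h1 : u' 1 - u' 0 = u 1 - u 0 := by rw [h 1, h 0]; abel
      have h2 : u' 2 - u' 0 = u 2 - u 0 := by rw [h 2, h 0]; abel
      ext1 n
      simp [uThetaFun, h1, h2])

theorem uTheta_eq_evalChain : G.uTheta x = evalChain (G.ordArea x) := rfl

theorem ordArea_ordMk (u : Fin 3 → G.Coh A) (n : G.N) :
    G.ordArea x (ordMk _ u) n = wedge A (G.toCoh A n) (u 1 - u 0) (u 2 - u 0) := rfl

theorem uTheta_tmul_of (n : G.N) (u v w : G.Coh A) :
    G.uTheta x (n ⊗ₜ FreeAbelianGroup.of (ordMk _ ![u, v, w])) =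
      wedge A (G.toCoh A n) (v - u) (w - u) := by
  rw [uTheta_eq_evalChain, evalChain_tmul_of, ordArea_ordMk]
  rfl

/-- The chain `∑ n_e ⊗ ((u₀(e), u₁(e)) + (-u₀(e), -u₁(e)))`. -/
def symChain (u₀ u₁ : E → G.Coh A) : G.UChain x 1 :=
  ∑ e, G.dir e ⊗ₜ[ℤ] symEdge (G.lattice x) (u₀ e) (u₁ e)

variable {x} {G}

theorem symChain_congr {u₀ u₁ u₀' u₁' : E → G.Coh A}
    (h : ∀ e, ∃ a ∈ G.lattice x, u₀' e = u₀ e + a ∧ u₁' e = u₁ e + a) :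
    G.symChain x u₀' u₁' = G.symChain x u₀ u₁ := by
  refine Finset.sum_congr rfl fun e _ => ?_
  obtain ⟨a, ha, h0, h1⟩ := h e
  rw [h0, h1, symEdge_add_right ha]

/-- `u₀` and `u₁` lift the endpoints of the images of the edges under the map
`V → N_A / Λ` induced by `f`. -/
structure IsEdgeLift (x : E → A) (f : V → G.Coh A) (u₀ u₁ : E → G.Coh A) : Prop where
  tail_mem : ∀ e, u₀ e - f (G.tail e) ∈ G.lattice x
  head_mem : ∀ e, u₁ e - f (G.head e) ∈ G.lattice x

namespace IsEdgeLift

variable {f : V → G.Coh A} {u₀ u₁ : E → G.Coh A}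

theorem sum_dir_tmul_sub_eq_zero (h : IsEdgeLift x f u₀ u₁) {X : Type*} [AddCommGroup X]
    (F : G.Coh A → X) (hF : ∀ a ∈ G.lattice x, ∀ u, F (u + a) = F u) :
    ∑ e, G.dir e ⊗ₜ[ℤ] (F (u₁ e) - F (u₀ e)) = 0 := by
  rw [← G.sum_dir_tmul_sub fun v => F (f v)]
  refine Finset.sum_congr rfl fun e _ => ?_
  rw [← hF _ (h.head_mem e) (f _), ← hF _ (h.tail_mem e) (f _), add_sub_cancel, add_sub_cancel]

theorem exists_uBdry_eq_symChain (h : IsEdgeLift x f u₀ u₁) :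
    ∃ S, G.uBdry x 1 S = G.symChain x u₀ u₁ := by
  refine exists_bdryChain_eq (ordFace (G.lattice x)) _ ?_
  rw [symChain, map_sum, ← h.sum_dir_tmul_sub_eq_zero (symPotential (G.lattice x))
    fun a ha => symPotential_add ha]
  refine Finset.sum_congr rfl fun e _ => ?_
  rw [LinearMap.lTensor_tmul, ← mk_symEdge]
  rfl

end IsEdgeLift

variable (G x) in
/-- The boundaries of the chains of area zero. -/
def flatBdry : AddSubgroup (G.UChain x 1) := (G.uTheta x).ker.map (G.uBdry x 1)

theorem symTriangle_mem_flatBdry (n : G.N) (u v w : G.Coh A)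
    (hflat : wedge A (G.toCoh A n) (v - u) (w - u) = 0) :
    n ⊗ₜ[ℤ] (symEdge (G.lattice x) v w - symEdge (G.lattice x) u w + symEdge (G.lattice x) u v) ∈
      G.flatBdry x := by
  refine ⟨n ⊗ₜ (FreeAbelianGroup.of (ordMk _ ![u, v, w]) +
    FreeAbelianGroup.of (ordMk _ ![-u, -v, -w])), ?_, ?_⟩
  · have hneg : wedge A (G.toCoh A n) (-v - -u) (-w - -u) = 0 := by
      rw [← neg_sub', ← neg_sub', wedge_neg_mid, wedge_neg_right, neg_neg, hflat]
    rw [SetLike.mem_coe, AddMonoidHom.mem_ker, TensorProduct.tmul_add, map_add, uTheta_tmul_of,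
      uTheta_tmul_of, hflat, hneg, add_zero]
  · rw [uBdry_eq_bdryChain, bdryChain_tmul, altBdry_symTriangle]

theorem symEdge_subdivision_mem_flatBdry (n : G.N) {u v : G.Coh A} (w : G.Coh A) {c : A}
    (hpar : v - u = c • G.toCoh A n) :
    n ⊗ₜ[ℤ] (symEdge (G.lattice x) u v + symEdge (G.lattice x) v w) -
      n ⊗ₜ[ℤ] symEdge (G.lattice x) u w ∈ G.flatBdry x := by
  rw [← TensorProduct.tmul_sub, add_comm, add_sub_right_comm]
  refine symTriangle_mem_flatBdry n u v w ?_
  rw [hpar, wedge_smul_mid, wedge_self_left, smul_zero]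

/-- The prism over an edge parallel to `n`, cut into two triangles, has no area. -/
theorem symEdge_prism_mem_flatBdry (n : G.N) {u v : G.Coh A} (w : G.Coh A) {c : A}
    (hpar : v - u = c • G.toCoh A n) :
    n ⊗ₜ[ℤ] (symEdge (G.lattice x) u v - symEdge (G.lattice x) (u + w) (v + w)) +
      n ⊗ₜ[ℤ] (symEdge (G.lattice x) v (v + w) - symEdge (G.lattice x) u (u + w)) ∈
      G.flatBdry x := by
  have hlower : wedge A (G.toCoh A n) (v - u) (v + w - u) = 0 := by
    rw [hpar, wedge_smul_mid, wedge_self_left, smul_zero]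
  have hupper : wedge A (G.toCoh A n) (u + w - u) (v + w - u) = 0 := by
    rw [add_sub_cancel_left, add_sub_right_comm, hpar, wedge_add_right, wedge_self_right, add_zero,
      wedge_smul_right, wedge_swap_right, wedge_self_left, neg_zero, smul_zero]
  have h := sub_mem (symTriangle_mem_flatBdry (x := x) n _ _ _ hlower)
    (symTriangle_mem_flatBdry (x := x) n _ _ _ hupper)
  rw [← TensorProduct.tmul_sub] at h
  rw [← TensorProduct.tmul_add]
  convert h using 2
  abel

theorem IsEdgeLift.symChain_sub_translate_mem {f : V → G.Coh A} {u₀ u₁ : E → G.Coh A}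
    (h : IsEdgeLift x f u₀ u₁) (hpar : ∀ e, ∃ c : A, u₁ e - u₀ e = c • G.toCoh A (G.dir e))
    (w : G.Coh A) :
    G.symChain x u₀ u₁ - G.symChain x (fun e => u₀ e + w) (fun e => u₁ e + w) ∈
      G.flatBdry x := by
  have hvertical : ∑ e, G.dir e ⊗ₜ[ℤ] (symEdge (G.lattice x) (u₁ e) (u₁ e + w) -
      symEdge (G.lattice x) (u₀ e) (u₀ e + w)) = 0 :=
    h.sum_dir_tmul_sub_eq_zero (fun u => symEdge (G.lattice x) u (u + w)) fun a ha u => by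
      rw [add_right_comm, symEdge_add_right ha]
  rw [← add_zero (_ - _), ← hvertical, symChain, symChain, ← Finset.sum_sub_distrib,
    ← Finset.sum_add_distrib]
  refine sum_mem fun e _ => ?_
  obtain ⟨c, hc⟩ := hpar e
  rw [← TensorProduct.tmul_sub]
  exact symEdge_prism_mem_flatBdry (G.dir e) w hc

/-! ### Ceresa cycles -/

section Path

variable (G) (x) (v : V) (e : E)

/-- `π(δ_e)` for a path `δ_e` from `v` to `e⁻`. -/
def pathTail : G.Coh A := G.proj x (G.path v (G.tail e))

/-- `π(δ_e + e)` for a path `δ_e` from `v` to `e⁻`. -/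
def pathHead : G.Coh A := G.proj x (G.path v (G.tail e) + Finsupp.single e 1)

theorem pathHead_eq : G.pathHead x v e = G.pathTail x v e + x e • G.toCoh A (G.dir e) := by
  rw [pathHead, pathTail, map_add, smul_dir]

theorem isEdgeLift_path (o : G.Coh A) :
    IsEdgeLift x (fun w => G.proj x (G.path v w) + o) (fun e => G.pathTail x v e + o)
      (fun e => G.pathHead x v e + o) where
  tail_mem e := by simp [pathTail]
  head_mem e := by
    rw [add_sub_add_right_eq_sub]
    refine G.proj_sub_proj_mem_lattice x ?_
    rw [map_add, bdry_path, bdry_path, bdry_single]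
    abel

theorem uCer_eq_symChain : G.uCer x v = G.symChain x (G.pathTail x v) (G.pathHead x v) := by
  have hphi (e : E) : G.uPhi x v e = G.dir e ⊗ₜ[ℤ] FreeAbelianGroup.of
      (ordMk (G.lattice x) ![G.pathTail x v e, G.pathHead x v e]) := rfl
  have hneg (e : E) : G.uNeg x 1 (G.uPhi x v e) = -(G.dir e ⊗ₜ[ℤ] FreeAbelianGroup.of
      (ordMk (G.lattice x) ![-G.pathTail x v e, -G.pathHead x v e])) := by
    rw [hphi, ← ordNeg_edge, ← TensorProduct.neg_tmul]
    rfl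
  rw [uCer, map_sum, ← Finset.sum_sub_distrib, symChain]
  refine Finset.sum_congr rfl fun e _ => ?_
  rw [hneg, hphi, sub_neg_eq_add, ← TensorProduct.tmul_add, symEdge]

theorem exists_uBdry_eq_uCer : ∃ S, G.uBdry x 1 S = G.uCer x v := by
  rw [uCer_eq_symChain]
  simpa only [add_zero] using (G.isEdgeLift_path x v 0).exists_uBdry_eq_symChain

/-- A change of the base point translates the image of the graph. -/
theorem symChain_path_sub_uCer_mem (w : V) (o : G.Coh A) :
    G.symChain x (fun e => G.pathTail x w e + o) (fun e => G.pathHead x w e + o) - G.uCer x v ∈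
      G.flatBdry x := by
  have hmem (e : E) : G.pathTail x v e - (G.pathTail x w e + G.proj x (G.path v w)) ∈
      G.lattice x := by
    rw [pathTail, pathTail, ← map_add]
    refine G.proj_sub_proj_mem_lattice x ?_
    rw [map_add, bdry_path, bdry_path, bdry_path]
    abel
  have hcer : G.uCer x v = G.symChain x
      (fun e => G.pathTail x w e + o + (G.proj x (G.path v w) - o))
      (fun e => G.pathHead x w e + o + (G.proj x (G.path v w) - o)) := by
    rw [uCer_eq_symChain]
    refine symChain_congr fun e => ⟨_, hmem e, by abel, ?_⟩
    rw [pathHead_eq, pathHead_eq]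
    abel
  rw [hcer]
  refine (G.isEdgeLift_path x w o).symChain_sub_translate_mem (fun e => ⟨x e, ?_⟩) _
  rw [pathHead_eq]
  abel

end Path

end MGraph

namespace MGraph

variable {V E : Type*} (G : MGraph V E)

theorem evRing_X (l : E → ℝ) (e : E) : evRing l (MvPolynomial.X e) = l e := by
  simp [evRing]

theorem evCoh_toCoh (l : E → ℝ) (n : G.N) : G.evCoh l (G.toCoh _ n) = G.toCoh ℝ n := by
  ext γ
  change evRing l (G.toCoh _ n γ) = _
  simp [evRing]

theorem evExt_wedge (l : E → ℝ) (a b c : G.Coh (MvPolynomial E ℤ)) :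
    G.evExt l (wedge _ a b c) = wedge ℝ (G.evCoh l a) (G.evCoh l b) (G.evCoh l c) := by
  change extMap (evRing l) 3 (G.evCoh l) _ = _
  rw [wedge, extMap_ιMulti, wedge]
  congr 1
  ext i : 1; fin_cases i <;> rfl

/-- The cochain whose coboundary is the change of area of an ordered triangle when its vertices
are moved by `ρ`, see `wedge_move_vertices`. -/
def areaHomotopyFun {A : Type*} [CommRing A] (ρ : G.Coh A → G.Coh A) (u : Fin 2 → G.Coh A) :
    G.N →ₗ[ℤ] ⋀[A]^3 (G.Coh A) :=
  AddMonoidHom.toIntLinearMap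
    { toFun := fun n => wedge A (G.toCoh A n) (ρ (u 0) - u 0) (ρ (u 1) - u 1) -
        wedge A (G.toCoh A n) (u 1 - u 0) ((ρ (u 0) - u 0) + (ρ (u 1) - u 1))
      map_zero' := by simp
      map_add' := fun n n' => by
        rw [map_add, wedge_add_left, wedge_add_left]
        abel }

theorem areaHomotopyFun_apply {A : Type*} [CommRing A] (ρ : G.Coh A → G.Coh A)
    (u : Fin 2 → G.Coh A) (n : G.N) :
    G.areaHomotopyFun ρ u n = wedge A (G.toCoh A n) (ρ (u 0) - u 0) (ρ (u 1) - u 1) -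
        wedge A (G.toCoh A n) (u 1 - u 0) ((ρ (u 0) - u 0) + (ρ (u 1) - u 1)) := rfl

theorem segments_eq {l : E → ℝ} (p : Point (V := V) l) (e : E) :
    segments l p e = [(0, l e)] ∨ ∃ t, segments l p e = [(0, t), (t, l e)] := by
  unfold segments
  split
  · exact .inl rfl
  · split_ifs
    · exact .inr ⟨_, rfl⟩
    · exact .inl rfl

variable [Fintype E]

section Equivariant

variable {A : Type*} [CommRing A] (x : E → A)

/-- The cochain `areaHomotopyFun` on ordered edges modulo `Λ`. -/
def areaHomotopy (ρ : G.Coh A → G.Coh A) (hρ : ∀ a ∈ G.lattice x, ∀ u, ρ (u + a) = ρ u + a)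
    (s : OrdSimplex (G.lattice x) 1) : G.N →ₗ[ℤ] ⋀[A]^3 (G.Coh A) :=
  Quotient.liftOn s (G.areaHomotopyFun ρ) (by
      rintro u u' ⟨a, ha, h⟩
      ext1 n
      simp only [areaHomotopyFun_apply, h, hρ a ha, add_sub_add_right_eq_sub])

theorem ordArea_ordMap (ρ : G.Coh A → G.Coh A)
    (hρ : ∀ a ∈ G.lattice x, ∀ u, ρ (u + a) = ρ u + a) (s : OrdSimplex (G.lattice x) 2)
    (n : G.N) :
    G.ordArea x (ordMap ρ (fun a ha => ⟨a, ha, hρ a ha⟩) s) n = G.ordArea x s n +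
      ∑ i : Fin 3, (-1 : ℤ) ^ (i : ℕ) • G.areaHomotopy x ρ hρ (ordFace (G.lattice x) i s) n := by
  induction s using Quotient.inductionOn with
  | h u =>
    have key := wedge_move_vertices (A := A) (G.toCoh A n) (u 0) (u 1) (u 2) (ρ (u 0) - u 0)
      (ρ (u 1) - u 1) (ρ (u 2) - u 2)
    simp only [add_sub_cancel] at key
    rw [← ordMk, ordMap_ordMk, ordArea_ordMk, ordArea_ordMk, key, Fin.sum_univ_three]
    simp only [Fin.val_zero, Fin.val_one, Fin.val_two, pow_zero, pow_one, one_smul, neg_smul,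
      neg_one_sq, ← sub_eq_add_neg]
    rfl

variable {G x} in
theorem uTheta_pushChain_ordMap (ρ : G.Coh A → G.Coh A)
    (hρ : ∀ a ∈ G.lattice x, ∀ u, ρ (u + a) = ρ u + a) {c : G.UChain x 2}
    (hc : G.uBdry x 1 c = 0) :
    G.uTheta x (pushChain G.N (ordMap ρ fun a ha => ⟨a, ha, hρ a ha⟩) c) = G.uTheta x c := by
  rw [uTheta_eq_evalChain, evalChain_pushChain,
    evalChain_add_coboundary (G.areaHomotopy x ρ hρ) (G.ordArea_ordMap x ρ hρ),
    ← uBdry_eq_bdryChain, hc, map_zero, add_zero]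

end Equivariant

/-! ### Evaluation -/

section Evaluation

variable (l : E → ℝ)

theorem evCoh_proj (c : E →₀ ℤ) : G.evCoh l (G.proj (vars E) c) = G.proj l c := by
  ext γ
  change evRing l (G.proj (vars E) c γ) = _
  simp [pairing, evRing_X]

theorem evCoh_equivariant : ∀ a ∈ G.lattice (vars E), ∃ a' ∈ G.lattice l,
    ∀ u, G.evCoh l (u + a) = G.evCoh l u + a' := by
  rintro _ ⟨c, hc, rfl⟩
  exact ⟨G.proj l c, ⟨c, hc, rfl⟩, fun u => by rw [map_add, evCoh_proj]⟩

/-- The map of chains of ordered simplices induced by `ev : N_R → N_ℝ`. -/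
def evChain (q : ℕ) : G.UChain (vars E) q →+ G.UChain l q :=
  pushChain G.N (ordMap (G.evCoh l) (G.evCoh_equivariant l))

theorem uBdry_evChain (q : ℕ) (c : G.UChain (vars E) (q + 1)) :
    G.uBdry l q (G.evChain l (q + 1) c) = G.evChain l q (G.uBdry (vars E) q c) :=
  bdryChain_pushChain (ordFace_ordMap _ _) c

theorem uTheta_evChain (c : G.UChain (vars E) 2) :
    G.uTheta l (G.evChain l 2 c) = G.evExt l (G.uTheta (vars E) c) := by
  rw [uTheta_eq_evalChain, evChain, evalChain_pushChain, uTheta_eq_evalChain]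
  refine (map_evalChain _ _ _ (fun s n => ?_) c).symm
  induction s using Quotient.inductionOn with
  | h u =>
    rw [← ordMk, ordMap_ordMk, ordArea_ordMk, ordArea_ordMk, evExt_wedge, evCoh_toCoh,
      map_sub, map_sub]

theorem evChain_uCer (v : V) : G.evChain l 1 (G.uCer (vars E) v) = G.uCer l v := by
  rw [uCer_eq_symChain, uCer_eq_symChain, symChain, symChain, map_sum]
  refine Finset.sum_congr rfl fun e _ => ?_
  rw [evChain, pushChain_tmul, map_ordMap_symEdge _ _ (map_neg _)]
  simp only [pathTail, pathHead, evCoh_proj]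

variable {l}

theorem proj_injOn_H1 (hl : ∀ e, 0 < l e) {c : E →₀ ℤ} (hc : c ∈ G.H1) (h : G.proj l c = 0) :
    c = 0 := by
  have hself : ∑ e, (c e : ℝ) * c e * l e = 0 := by
    simpa [pairing] using DFunLike.congr_fun h (⟨c, hc⟩ : G.H1)
  ext e
  have hterm := (Finset.sum_eq_zero_iff_of_nonneg fun e _ =>
    mul_nonneg (mul_self_nonneg (c e : ℝ)) (hl e).le).mp hself e (Finset.mem_univ e)
  exact_mod_cast mul_self_eq_zero.mp ((mul_eq_zero.mp hterm).resolve_right (hl e).ne')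

/-- As `Λ` acts freely on `N_ℝ`, an equivariant map is given by its values on representatives of
the orbits. -/
theorem exists_equivariant_lift (hl : ∀ e, 0 < l e) :
    ∃ σ : G.Coh ℝ → G.Coh (MvPolynomial E ℤ),
      ∀ c ∈ G.H1, ∀ u, σ (u + G.proj l c) = σ u + G.proj (vars E) c := by
  have hdisp (u : G.Coh ℝ) : ∃ c ∈ G.H1,
      G.proj l c = u - Quotient.out (QuotientAddGroup.mk u : G.Jac l) := by
    obtain ⟨c, hc, h⟩ : -Quotient.out (QuotientAddGroup.mk u : G.Jac l) + u ∈ G.lattice l :=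
      QuotientAddGroup.eq.mp (QuotientAddGroup.out_eq' _)
    exact ⟨c, hc, by rw [h]; abel⟩
  choose κ hκ hproj using hdisp
  refine ⟨fun u => G.proj (vars E) (κ u), fun c hc u => ?_⟩
  have hmk : (QuotientAddGroup.mk (u + G.proj l c) : G.Jac l) = QuotientAddGroup.mk u :=
    QuotientAddGroup.mk_add_of_mem u ⟨c, hc, rfl⟩
  have hadd : κ (u + G.proj l c) = κ u + c := by
    rw [← sub_eq_zero]
    refine G.proj_injOn_H1 hl (sub_mem (hκ _) (add_mem (hκ _) hc)) ?_
    rw [map_sub, map_add, hproj, hproj, hmk]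
    abel
  simp only [hadd, map_add]

theorem map_uPeriods_le : (G.uPeriods (vars E)).map (G.evExt l) ≤ G.uPeriods l := by
  rintro _ ⟨_, ⟨c, hc, rfl⟩, rfl⟩
  refine ⟨G.evChain l 2 c, ?_, G.uTheta_evChain l c⟩
  rw [SetLike.mem_coe, AddMonoidHom.mem_ker] at hc ⊢
  rw [uBdry_evChain, hc, map_zero]

theorem map_uPeriods (hl : ∀ e, 0 < l e) :
    (G.uPeriods (vars E)).map (G.evExt l) = G.uPeriods l := by
  refine le_antisymm G.map_uPeriods_le ?_
  rintro _ ⟨c, hc, rfl⟩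
  rw [SetLike.mem_coe, AddMonoidHom.mem_ker] at hc
  obtain ⟨σ, hσ⟩ := G.exists_equivariant_lift hl
  have hσ' : ∀ a ∈ G.lattice l, ∃ a' ∈ G.lattice (vars E), ∀ u, σ (u + a) = σ u + a' := by
    rintro _ ⟨d, hd, rfl⟩
    exact ⟨_, ⟨d, hd, rfl⟩, hσ d hd⟩
  have hρ : ∀ a ∈ G.lattice l, ∀ u, G.evCoh l (σ (u + a)) = G.evCoh l (σ u) + a := by
    rintro _ ⟨d, hd, rfl⟩ u
    rw [hσ d hd, map_add, evCoh_proj]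
  refine ⟨_, ⟨pushChain G.N (ordMap σ hσ') c, ?_, rfl⟩, ?_⟩
  · rw [SetLike.mem_coe, AddMonoidHom.mem_ker, uBdry_eq_bdryChain,
      bdryChain_pushChain (ordFace_ordMap _ _), ← uBdry_eq_bdryChain, hc, map_zero]
  · rw [← uTheta_evChain, evChain, pushChain_pushChain,
      ← uTheta_pushChain_ordMap (fun u => G.evCoh l (σ u)) hρ hc]
    congr 3
    exact funext fun s => ordMap_ordMap _ _ _ _ _ s

/-! ### The tropical Ceresa cycle as an ordered chain -/

variable (l) in
/-- The tropical Ceresa cycle, as a chain of ordered simplices. -/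
def ordCer (p : Point (V := V) l) : G.UChain l 1 :=
  ∑ e, ((segments l p e).map fun s => G.dir e ⊗ₜ[ℤ]
    symEdge (G.lattice l) (G.abelJacobi l p e s.1) (G.abelJacobi l p e s.2)).sum

theorem abelJacobi_sub (p : Point (V := V) l) (e : E) (a a' : ℝ) :
    G.abelJacobi l p e a' - G.abelJacobi l p e a = (a' - a) • G.toCoh ℝ (G.dir e) := by
  rw [abelJacobi, abelJacobi, sub_smul]; abel

theorem sum_segments_sub_mem (p : Point (V := V) l) (e : E) :
    ((segments l p e).map fun s => G.dir e ⊗ₜ[ℤ]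
        symEdge (G.lattice l) (G.abelJacobi l p e s.1) (G.abelJacobi l p e s.2)).sum -
      G.dir e ⊗ₜ[ℤ] symEdge (G.lattice l) (G.abelJacobi l p e 0) (G.abelJacobi l p e (l e)) ∈
      G.flatBdry l := by
  obtain h | ⟨t, h⟩ := segments_eq p e
  · simp only [h, List.map_cons, List.map_nil, List.sum_singleton, sub_self, zero_mem]
  · simp only [h, List.map_cons, List.map_nil, List.sum_cons, List.sum_nil, add_zero,
      ← TensorProduct.tmul_add]
    exact symEdge_subdivision_mem_flatBdry _ _ (G.abelJacobi_sub p e 0 t)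

theorem abelJacobi_zero (p : Point (V := V) l) (e : E) :
    G.abelJacobi l p e 0 = G.pathTail l (G.baseVertex l p) e + -G.offset l p := by
  rw [abelJacobi, zero_smul, add_zero, pathTail, sub_eq_add_neg]

theorem abelJacobi_length (p : Point (V := V) l) (e : E) :
    G.abelJacobi l p e (l e) = G.pathHead l (G.baseVertex l p) e + -G.offset l p := by
  rw [abelJacobi, pathHead_eq, pathTail, sub_eq_add_neg, add_right_comm]

theorem ordCer_sub_uCer_mem (v : V) (p : Point (V := V) l) :
    G.ordCer l p - G.uCer l v ∈ G.flatBdry l := by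
  have hsubdiv := sum_mem (t := Finset.univ) fun e _ => G.sum_segments_sub_mem p e
  have htranslate := G.symChain_path_sub_uCer_mem l v (G.baseVertex l p) (-G.offset l p)
  simp only [← abelJacobi_zero, ← abelJacobi_length] at htranslate
  rw [Finset.sum_sub_distrib] at hsubdiv
  rw [← sub_add_sub_cancel]
  exact add_mem hsubdiv htranslate

theorem exists_uBdry_eq_ordCer (p : Point (V := V) l) : ∃ S, G.uBdry l 1 S = G.ordCer l p := by
  obtain ⟨v⟩ := G.nonempty
  obtain ⟨D, -, hD⟩ := G.ordCer_sub_uCer_mem v p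
  obtain ⟨S, hS⟩ := G.exists_uBdry_eq_uCer l v
  exact ⟨D + S, by rw [map_add, hD, hS, sub_add_cancel]⟩

end Evaluation

end MGraph

/-! ### Lifting to the universal cover of a torus -/

section Lift

open Filter Topology

theorem exists_continuous_lift_of_contractible {X Y Z : Type*} [TopologicalSpace X]
    [ContractibleSpace X] [TopologicalSpace Y] [TopologicalSpace Z] {p : Y → Z}
    (hp : IsCoveringMap p) (hsurj : Function.Surjective p) (s : C(X, Z)) :
    ∃ c : C(X, Y), ∀ x, p (c x) = s x := by
  obtain ⟨x₀, ⟨H⟩⟩ := id_nullhomotopic X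
  obtain ⟨y₀, hy₀⟩ := hsurj (s x₀)
  let K : C(unitInterval × X, Z) := s.comp H.symm.toContinuousMap
  have hK : ∀ x, K (0, x) = p (ContinuousMap.const X y₀ x) := fun x => by simp [K, hy₀]
  refine ⟨(hp.liftHomotopy K _ hK).comp ((ContinuousMap.const X 1).prodMk (.id X)), fun x => ?_⟩
  simpa [K] using congr_fun (hp.liftHomotopy_lifts K _ hK) (1, x)

variable {W : Type*} [NormedAddCommGroup W] {L : AddSubgroup W} [DiscreteTopology L]

theorem eventually_sub_eq_of_mk_eq {X : Type*} [TopologicalSpace X] {f f' : X → W} {t : X}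
    (hf : ContinuousAt f t) (hf' : ContinuousAt f' t)
    (h : ∀ᶠ y in 𝓝 t, (QuotientAddGroup.mk (f y) : W ⧸ L) = QuotientAddGroup.mk (f' y)) :
    ∀ᶠ y in 𝓝 t, f' y - f y = f' t - f t := by
  have hmem : ∀ y, (QuotientAddGroup.mk (f y) : W ⧸ L) = QuotientAddGroup.mk (f' y) →
      f' y - f y ∈ L := fun y hy => by
    rw [sub_eq_neg_add]; exact QuotientAddGroup.eq.mp hy
  obtain ⟨U, hU, hUL⟩ := isOpen_induced_iff.mp (isOpen_discrete ({0} : Set L))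
  have hzero : ∀ a ∈ L, a ∈ U → a = 0 := fun a ha haU =>
    congrArg Subtype.val (hUL.le haU : (⟨a, ha⟩ : L) = 0)
  have h0 : (0 : W) ∈ U := hUL.ge (Set.mem_singleton (0 : L))
  have hnear : ∀ᶠ y in 𝓝 t, (f' y - f y) - (f' t - f t) ∈ U :=
    ((hf'.sub hf).sub continuousAt_const) (hU.mem_nhds (by simpa using h0))
  filter_upwards [h, hnear] with y hy hyU
  exact sub_eq_zero.mp (hzero _ (sub_mem (hmem y hy) (hmem t h.self_of_nhds)) hyU)

theorem exists_eq_add_of_mk_eq {X : Type*} [TopologicalSpace X] [ConnectedSpace X]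
    {f f' : X → W} (hf : Continuous f) (hf' : Continuous f')
    (h : ∀ y, (QuotientAddGroup.mk (f y) : W ⧸ L) = QuotientAddGroup.mk (f' y)) :
    ∃ a ∈ L, ∀ y, f' y = f y + a := by
  have hconst : IsLocallyConstant (fun y => f' y - f y) :=
    (IsLocallyConstant.iff_eventually_eq _).mpr fun t =>
      eventually_sub_eq_of_mk_eq hf.continuousAt hf'.continuousAt (.of_forall h)
  obtain ⟨t⟩ := ‹ConnectedSpace X›.toNonempty
  refine ⟨f' t - f t, ?_, fun y => ?_⟩
  · rw [sub_eq_neg_add]; exact QuotientAddGroup.eq.mp (h t)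
  · rw [← hconst.apply_eq_of_preconnectedSpace y t]; abel

variable [NormedSpace ℝ W] {D : Type*} [NormedAddCommGroup D] [NormedSpace ℝ D]

/-- `f` is smooth near `t` and lifts `s` on the part of `K` near `t`. -/
def IsSmoothLiftNear {K : Set D} (s : K → W ⧸ L) (t : D) (f : D → W) : Prop :=
  ∃ U, IsOpen U ∧ t ∈ U ∧ ContDiffOn ℝ ∞ f U ∧
    ∀ y : K, (y : D) ∈ U → QuotientAddGroup.mk (f y) = s y

variable {K : Set D} {s : K → W ⧸ L}

omit [DiscreteTopology L] in
theorem IsSmoothLiftNear.continuousAt {t : K} {f : D → W} (h : IsSmoothLiftNear s t f) :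
    ContinuousAt (fun y : K => f y) t := by
  obtain ⟨U, hU, ht, hf, -⟩ := h
  exact (hf.continuousOn.continuousAt (hU.mem_nhds ht)).comp continuous_subtype_val.continuousAt

omit [DiscreteTopology L] in
theorem IsSmoothLiftNear.eventually_mk_eq {t : K} {f : D → W} (h : IsSmoothLiftNear s t f) :
    ∀ᶠ y : K in 𝓝 t, QuotientAddGroup.mk (f y) = s y := by
  obtain ⟨U, hU, ht, -, hs⟩ := h
  filter_upwards [continuous_subtype_val.continuousAt (hU.mem_nhds ht)] with y hy using hs y hy

omit [DiscreteTopology L] in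
theorem continuous_of_isSmoothLiftNear (hs : ∀ t : K, ∃ f, IsSmoothLiftNear s t f) :
    Continuous s := by
  refine continuous_iff_continuousAt.mpr fun t => ?_
  obtain ⟨f, hf⟩ := hs t
  exact (QuotientAddGroup.continuous_mk.continuousAt.comp hf.continuousAt).congr
    hf.eventually_mk_eq

/-- Near `y`, a smooth local lift differs from the continuous lift `c` by a constant. -/
theorem IsSmoothLiftNear.exists_contDiffOn_eq {y : K} {f : D → W} (hf : IsSmoothLiftNear s y f)
    {c : K → W} (hc : Continuous c) (hcs : ∀ z, QuotientAddGroup.mk (c z) = s z) :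
    ∃ U ∈ 𝓝 (y : D), ∃ F : D → W, ContDiffOn ℝ ∞ F U ∧ ∀ z : K, (z : D) ∈ U → F z = c z := by
  have hconst := eventually_sub_eq_of_mk_eq (L := L) hf.continuousAt hc.continuousAt
    (hf.eventually_mk_eq.mono fun z hz => hz.trans (hcs z).symm)
  rw [nhds_subtype, eventually_comap] at hconst
  obtain ⟨U, hU, hy, hfU, -⟩ := hf
  refine ⟨_, inter_mem hconst (hU.mem_nhds hy), fun z => f z + (c y - f y),
    (hfU.mono Set.inter_subset_right).add contDiffOn_const, fun z hz => ?_⟩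
  simp only [← hz.1 z rfl, add_sub_cancel]

/-- The local smooth extensions of a continuous lift are glued by a partition of unity. -/
theorem exists_smooth_lift [FiniteDimensional ℝ D] (hK : IsClosed K) (hconv : Convex ℝ K)
    (hne : K.Nonempty) (hs : ∀ t : K, ∃ f, IsSmoothLiftNear s t f) :
    ∃ F : D → W, ContDiff ℝ ∞ F ∧ ∀ y : K, QuotientAddGroup.mk (F y) = s y := by
  have := hconv.contractibleSpace hne
  have hcov : IsCoveringMap (QuotientAddGroup.mk : W → W ⧸ L) :=
    (L.isAddQuotientCoveringMap_of_comm DiscreteTopology.isDiscrete).isCoveringMap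
  obtain ⟨c, hcs⟩ := exists_continuous_lift_of_contractible hcov QuotientAddGroup.mk_surjective
    ⟨s, continuous_of_isSmoothLiftNear hs⟩
  obtain ⟨F, hF⟩ := exists_contMDiffMap_forall_mem_convex_of_local (n := ⊤)
    (modelWithCornersSelf ℝ D) (t := fun y => {w : W | ∀ h : y ∈ K, w = c ⟨y, h⟩})
    (fun y w hw w' hw' α β _ _ hαβ h => by rw [hw h, hw' h, ← add_smul, hαβ, one_smul])
    (fun y => by
      by_cases hy : y ∈ K
      · obtain ⟨f, hf⟩ := hs ⟨y, hy⟩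
        obtain ⟨U, hU, F, hF, hFc⟩ := hf.exists_contDiffOn_eq c.continuous hcs
        exact ⟨U, hU, F, hF.contMDiffOn, fun z hz h => hFc ⟨z, h⟩ hz⟩
      · exact ⟨Kᶜ, hK.isOpen_compl.mem_nhds hy, fun _ => 0, contMDiffOn_const,
          fun z hz h => absurd h hz⟩)
  exact ⟨F, F.contMDiff.contDiff, fun y => by rw [hF y y.2]; exact hcs y⟩

end Lift

/-! ### Coordinates and lifts of smooth simplices -/

theorem eq_zero_of_mem_span_of_weighted_sum_eq_zero {ι κ : Type*} [Fintype ι] {l : ι → ℝ}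
    (hl : ∀ i, 0 < l i) {w : κ → ι → ℝ} {v : ι → ℝ} (hv : v ∈ Submodule.span ℝ (Set.range w))
    (h : ∀ k, ∑ i, v i * w k i * l i = 0) : v = 0 := by
  let φ : (ι → ℝ) →ₗ[ℝ] ℝ := Fintype.linearCombination ℝ fun i => v i * l i
  have hφ (u : ι → ℝ) : φ u = ∑ i, v i * u i * l i := by
    simp only [φ, Fintype.linearCombination_apply, smul_eq_mul]
    exact Finset.sum_congr rfl fun i _ => by ring
  have hspan : Submodule.span ℝ (Set.range w) ≤ LinearMap.ker φ := by
    rw [Submodule.span_le]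
    rintro _ ⟨k, rfl⟩
    exact (hφ _).trans (h k)
  have hself : ∑ i, v i * v i * l i = 0 := (hφ v).symm.trans (hspan hv)
  ext i
  have hterm := (Finset.sum_eq_zero_iff_of_nonneg fun i _ =>
    mul_nonneg (mul_self_nonneg (v i)) (hl i).le).mp hself i (Finset.mem_univ i)
  exact mul_self_eq_zero.mp ((mul_eq_zero.mp hterm).resolve_right (hl i).ne')

namespace MGraph

variable {V E : Type*} {G : MGraph V E} {g : ℕ} (b : Module.Basis (Fin g) ℤ G.H1)

theorem eps_apply (i : Fin g) (γ : G.H1) : G.eps b i γ = (b.repr γ i : ℝ) := rfl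

theorem Coh.apply_eq_sum (u : G.Coh ℝ) (γ : G.H1) : u γ = ∑ i, (b.repr γ i : ℝ) * u (b i) := by
  conv_lhs => rw [← b.sum_repr γ]
  simp only [map_sum, map_zsmul, zsmul_eq_mul]

/-- The coordinates `z_i(u) = u(b_i)` on `N_ℝ`. -/
def coords : G.Coh ℝ ≃ₗ[ℝ] (Fin g → ℝ) where
  toFun u i := u (b i)
  map_add' _ _ := rfl
  map_smul' _ _ := rfl
  invFun w := ∑ i, w i • G.eps b i
  left_inv u := by
    ext γ
    rw [u.apply_eq_sum b γ, Coh.sum_apply]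
    exact Finset.sum_congr rfl fun i _ => by rw [Coh.smul_apply, eps_apply, mul_comm]
  right_inv w := by
    ext j
    simp [eps_apply, Finsupp.single_apply]

@[simp] theorem coords_apply (u : G.Coh ℝ) (i : Fin g) : coords b u i = u (b i) := rfl

variable [Fintype E] {l : E → ℝ}

variable (l) in
/-- The lattice `Λ_C` in coordinates. -/
abbrev coordLattice : AddSubgroup (Fin g → ℝ) :=
  (G.lattice l).map (coords b).toLinearMap.toAddMonoidHom

/-- By positivity of `[·, ·]`, cycles are recovered continuously from their periods. -/
theorem exists_leftInverse_coords_proj (hl : ∀ e, 0 < l e) :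
    ∃ r : (Fin g → ℝ) →L[ℝ] (E → ℝ), ∀ c ∈ G.H1,
      r (coords b (G.proj l c)) = fun e => (c e : ℝ) := by
  let cycle : G.H1 →ₗ[ℤ] E → ℝ :=
    { toFun := fun γ e => ((γ : E →₀ ℤ) e : ℝ)
      map_add' := fun γ γ' => by ext e; simp
      map_smul' := fun k γ => by ext e; simp }
  let S := Submodule.span ℝ (Set.range fun i => cycle (b i))
  have hS (γ : G.H1) : cycle γ ∈ S := by
    rw [← b.sum_repr γ, map_sum]
    refine sum_mem fun i _ => ?_
    rw [map_zsmul]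
    exact S.smul_of_tower_mem _ (Submodule.subset_span (Set.mem_range_self i))
  let T : S →ₗ[ℝ] Fin g → ℝ :=
    LinearMap.pi fun i => (Fintype.linearCombination ℝ fun e => cycle (b i) e * l e) ∘ₗ S.subtype
  have hT (v : S) (i : Fin g) : T v i = ∑ e, (v : E → ℝ) e * cycle (b i) e * l e := by
    simp [T, Fintype.linearCombination_apply, mul_assoc]
  have hker : LinearMap.ker T = ⊥ := LinearMap.ker_eq_bot'.mpr fun v hv =>
    Subtype.ext <| eq_zero_of_mem_span_of_weighted_sum_eq_zero hl v.2 fun i => by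
      rw [← hT, hv, Pi.zero_apply]
  obtain ⟨r, hr⟩ := T.exists_leftInverse_of_injective hker
  refine ⟨LinearMap.toContinuousLinearMap (S.subtype ∘ₗ r), fun c hc => ?_⟩
  have hTc : T ⟨cycle ⟨c, hc⟩, hS _⟩ = coords b (G.proj l c) := by
    ext i
    simp [hT, pairing, cycle]
  rw [← hTc]
  exact congrArg Subtype.val (LinearMap.congr_fun hr _)

theorem discreteTopology_coordLattice (hl : ∀ e, 0 < l e) :
    DiscreteTopology (coordLattice b l) := by
  obtain ⟨r, hr⟩ := exists_leftInverse_coords_proj b hl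
  have hcycle (w : coordLattice b l) : ∃ c ∈ G.H1, coords b (G.proj l c) = w := by
    obtain ⟨_, _, ⟨c, hc, rfl⟩, rfl⟩ := w
    exact ⟨c, hc, rfl⟩
  choose κ hκ hκw using hcycle
  have hemb : Topology.IsEmbedding (Pi.map fun _ => Int.cast : (E → ℤ) → E → ℝ) :=
    .piMap fun _ => Int.isClosedEmbedding_coe_real.isEmbedding
  refine .of_continuous_injective (f := fun w e => κ w e) (hemb.continuous_iff.mpr ?_) ?_
  · have : Continuous fun w : coordLattice b l => r w := by fun_prop
    convert this using 2 with w
    rw [← hκw, hr _ (hκ w)]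
    rfl
  · intro w w' h
    rw [Subtype.ext_iff, ← hκw w, ← hκw w', DFunLike.coe_injective h]

variable (l) in
/-- `Jac(C)` as a quotient of the coordinate space. -/
def jacEquiv : G.Jac l ≃+ (Fin g → ℝ) ⧸ coordLattice b l :=
  QuotientAddGroup.congr _ _ (coords b).toAddEquiv rfl

theorem mk_coords (u : G.Coh ℝ) :
    (QuotientAddGroup.mk (coords b u) : (Fin g → ℝ) ⧸ coordLattice b l) =
      jacEquiv b l (QuotientAddGroup.mk u) := rfl

theorem IsLocalLift.isSmoothLiftNear {q : ℕ} {s : stdSimplex ℝ (Fin (q + 1)) → G.Jac l}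
    {t : Fin (q + 1) → ℝ} {f : (Fin (q + 1) → ℝ) → G.Coh ℝ} (h : G.IsLocalLift l s t f) :
    IsSmoothLiftNear (fun y => jacEquiv b l (s y)) t fun y => coords b (f y) := by
  obtain ⟨U, hU, ht, hf, hs⟩ := h
  exact ⟨U, hU, ht, contDiffOn_pi.mpr fun i => hf (b i), fun y hy =>
    (mk_coords b _).trans (congrArg (jacEquiv b l) (hs y hy))⟩

/-- `F` is a smooth map `ℝ^{q+1} → N_ℝ` lifting the simplex `s`. -/
structure IsSmoothLift {q : ℕ} (s : G.SmoothSimplex l q) (F : (Fin (q + 1) → ℝ) → G.Coh ℝ) :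
    Prop where
  contDiff : ∀ γ : G.H1, ContDiff ℝ ∞ (fun y => F y γ)
  mk_eq : ∀ y : stdSimplex ℝ (Fin (q + 1)), QuotientAddGroup.mk (F y) = s.1 y

namespace IsSmoothLift

variable {q : ℕ} {s : G.SmoothSimplex l q} {F F' : (Fin (q + 1) → ℝ) → G.Coh ℝ}

theorem contDiff_coords (h : IsSmoothLift s F) : ContDiff ℝ ∞ (fun y => coords b (F y)) :=
  contDiff_pi.mpr fun i => h.contDiff (b i)

include b in
theorem exists_eq_add (hl : ∀ e, 0 < l e) (h : IsSmoothLift s F) (h' : IsSmoothLift s F') :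
    ∃ a ∈ G.lattice l, ∀ y ∈ stdSimplex ℝ (Fin (q + 1)), F' y = F y + a := by
  have := discreteTopology_coordLattice b hl
  have : ConnectedSpace (stdSimplex ℝ (Fin (q + 1))) :=
    isConnected_iff_connectedSpace.mp ((convex_stdSimplex ℝ _).isConnected
      ⟨_, single_mem_stdSimplex ℝ 0⟩)
  obtain ⟨_, ⟨a, ha, rfl⟩, hadd⟩ := exists_eq_add_of_mk_eq (L := coordLattice b l)
    ((h.contDiff_coords b).continuous.comp continuous_subtype_val)
    ((h'.contDiff_coords b).continuous.comp continuous_subtype_val)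
    (fun y => congrArg (jacEquiv b l) ((h.mk_eq y).trans (h'.mk_eq y).symm))
  exact ⟨a, ha, fun y hy => (coords b).injective ((hadd ⟨y, hy⟩).trans (map_add _ _ _).symm)⟩

end IsSmoothLift

include b in
theorem exists_isSmoothLift (hl : ∀ e, 0 < l e) {q : ℕ} (s : G.SmoothSimplex l q) :
    ∃ F, IsSmoothLift s F := by
  have := discreteTopology_coordLattice b hl
  obtain ⟨F, hF, hFs⟩ := exists_smooth_lift (isClosed_stdSimplex ℝ _) (convex_stdSimplex ℝ _)
    ⟨_, single_mem_stdSimplex ℝ 0⟩ (fun t => (s.2 t).imp' _ fun f hf => hf.isSmoothLiftNear b)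
  refine ⟨fun y => (coords b).symm (F y), fun γ => ?_, fun y => (jacEquiv b l).injective ?_⟩
  · have hcoord (y) : (coords b).symm (F y) γ = ∑ i, (b.repr γ i : ℝ) * F y i := by
      rw [Coh.apply_eq_sum b]
      simp only [← coords_apply b, LinearEquiv.apply_symm_apply]
    simp_rw [hcoord]
    exact ContDiff.sum fun i _ => contDiff_const.mul (contDiff_pi.mp hF i)
  · rw [← mk_coords, LinearEquiv.apply_symm_apply]
    exact hFs y

end MGraph

/-! ### Stokes' theorem for the triangle -/

section Stokes

open MeasureTheory Set

/-- The triangle over which `integral2` integrates. -/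
def triangle : Set (ℝ × ℝ) := {y | 0 ≤ y.1 ∧ 0 ≤ y.2 ∧ y.1 + y.2 ≤ 1}

theorem convex_triangle : Convex ℝ triangle := by
  rintro x ⟨h1, h2, h3⟩ y ⟨h1', h2', h3'⟩ a b ha hb hab
  refine ⟨?_, ?_, ?_⟩
  · exact add_nonneg (mul_nonneg ha h1) (mul_nonneg hb h1')
  · exact add_nonneg (mul_nonneg ha h2) (mul_nonneg hb h2')
  · calc (a • x + b • y).1 + (a • x + b • y).2 = a * (x.1 + x.2) + b * (y.1 + y.2) := by
          simp only [Prod.fst_add, Prod.snd_add, Prod.smul_fst, Prod.smul_snd, smul_eq_mul]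
          ring
      _ ≤ a * 1 + b * 1 := by gcongr
      _ = 1 := by linarith

theorem isCompact_triangle : IsCompact triangle := by
  have hclosed : IsClosed triangle :=
    (isClosed_le continuous_const continuous_fst).inter
      ((isClosed_le continuous_const continuous_snd).inter
        (isClosed_le (continuous_fst.add continuous_snd) continuous_const))
  have hbox : IsCompact (Icc (0 : ℝ) 1 ×ˢ Icc (0 : ℝ) 1) := isCompact_Icc.prod isCompact_Icc
  refine hbox.of_isClosed_subset hclosed ?_
  rintro y ⟨h1, h2, h3⟩
  exact ⟨⟨h1, by linarith⟩, ⟨h2, by linarith⟩⟩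

theorem ae_mem_interior_triangle : ∀ᵐ y : ℝ × ℝ, y ∈ triangle → y ∈ interior triangle := by
  have h := convex_triangle.addHaar_frontier (volume : Measure (ℝ × ℝ))
  filter_upwards [measure_eq_zero_iff_ae_notMem.mp h] with y hy hyT
  by_contra hint
  exact hy ⟨subset_closure hyT, hint⟩

theorem setIntegral_triangle {f : ℝ × ℝ → ℝ} (hf : Continuous f) :
    ∫ y in triangle, f y = ∫ s in (0 : ℝ)..1, ∫ t in (0 : ℝ)..(1 - s), f (s, t) := by
  have hm := isCompact_triangle.measurableSet
  have hi : Integrable (triangle.indicator f) :=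
    (integrable_indicator_iff hm).mpr (hf.continuousOn.integrableOn_compact isCompact_triangle)
  rw [← integral_indicator hm, Measure.volume_eq_prod, integral_prod _ hi,
    intervalIntegral.integral_of_le zero_le_one, ← integral_Icc_eq_integral_Ioc,
    ← integral_indicator measurableSet_Icc]
  congr 1
  ext s
  by_cases hs : s ∈ Icc (0 : ℝ) 1
  · rw [indicator_of_mem hs, intervalIntegral.integral_of_le (by linarith [hs.2]),
      ← integral_Icc_eq_integral_Ioc, ← integral_indicator measurableSet_Icc]
    congr 1
    ext t
    by_cases ht : t ∈ Icc (0 : ℝ) (1 - s)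
    · rw [indicator_of_mem ht, indicator_of_mem]
      exact ⟨hs.1, ht.1, by linarith [ht.2]⟩
    · rw [indicator_of_notMem ht, indicator_of_notMem]
      rintro ⟨-, h2, h3⟩
      exact ht ⟨h2, by simp only at h3; linarith⟩
  · rw [indicator_of_notMem hs]
    refine integral_eq_zero_of_ae (Filter.Eventually.of_forall fun t => ?_)
    refine indicator_of_notMem ?_ _
    rintro ⟨h1, h2, h3⟩
    exact hs ⟨h1, by simp only at h2 h3; linarith⟩

theorem setIntegral_triangle_swap {f : ℝ × ℝ → ℝ} (hf : Continuous f) :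
    ∫ y in triangle, f y = ∫ t in (0 : ℝ)..1, ∫ s in (0 : ℝ)..(1 - t), f (s, t) := by
  refine Eq.trans ?_ (setIntegral_triangle (f := fun y => f y.swap) (by fun_prop))
  have h := (Measure.measurePreserving_swap (μ := (volume : Measure ℝ))
    (ν := (volume : Measure ℝ))).setIntegral_preimage_emb
    (MeasurableEquiv.prodComm.measurableEmbedding) f triangle
  rw [Measure.volume_eq_prod, ← h]
  congr 2
  ext y
  simp only [triangle, mem_preimage, mem_ofPred_eq, Prod.fst_swap, Prod.snd_swap]
  rw [add_comm]; tauto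

/-- `∫ a db` along the path `t ↦ (a t, b t)`, `0 ≤ t ≤ 1`, minus its value along the segment with
the same end points; the factor `(a 0 + a 1) / 2` is the mean value of `a` along that segment. -/
def pathDefect (a b : ℝ → ℝ) : ℝ := ∫ t in (0 : ℝ)..1, (a t - (a 0 + a 1) / 2) * deriv b t

theorem pathDefect_eq_sub {a b : ℝ → ℝ} (ha : Continuous a) (hb : ContDiff ℝ 1 b) :
    pathDefect a b = (∫ t in (0 : ℝ)..1, a t * deriv b t) - (a 0 + a 1) / 2 * (b 1 - b 0) := by
  have hb' : Continuous (deriv b) := hb.continuous_deriv_one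
  have hint : ∫ t in (0 : ℝ)..1, deriv b t = b 1 - b 0 :=
    intervalIntegral.integral_deriv_eq_sub (fun t _ => hb.differentiable one_ne_zero t)
      (hb'.intervalIntegrable _ _)
  simp only [pathDefect, sub_mul]
  rw [intervalIntegral.integral_sub (Continuous.intervalIntegrable (by fun_prop) _ _)
    (Continuous.intervalIntegrable (by fun_prop) _ _), intervalIntegral.integral_const_mul, hint]

theorem pathDefect_add_const {a a' b b' : ℝ → ℝ} {α β : ℝ}
    (ha : ∀ t ∈ Icc (0 : ℝ) 1, a' t = a t + α) (hb : ∀ t ∈ Icc (0 : ℝ) 1, b' t = b t + β) :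
    pathDefect a' b' = pathDefect a b := by
  simp only [pathDefect, intervalIntegral.integral_of_le zero_le_one, integral_Ioc_eq_integral_Ioo]
  refine setIntegral_congr_fun measurableSet_Ioo fun t ht => ?_
  have hderiv : deriv b' t = deriv b t := by
    have hev : b' =ᶠ[nhds t] fun t => b t + β := by
      filter_upwards [Icc_mem_nhds ht.1 ht.2] with τ hτ using hb τ hτ
    rw [hev.deriv_eq, deriv_add_const]
  simp only [hderiv, ha t (Ioo_subset_Icc_self ht), ha 0 (by simp), ha 1 (by simp)]
  ring

theorem pathDefect_affine (a₀ a₁ b₀ b₁ : ℝ) :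
    pathDefect (fun t => (1 - t) * a₀ + t * a₁) (fun t => (1 - t) * b₀ + t * b₁) = 0 := by
  have hderiv (t : ℝ) : deriv (fun t : ℝ => (1 - t) * b₀ + t * b₁) t = b₁ - b₀ := by
    have h : HasDerivAt (fun t : ℝ => (1 - t) * b₀ + t * b₁) (-1 * b₀ + 1 * b₁) t :=
      (((hasDerivAt_id t).const_sub 1).mul_const _).add ((hasDerivAt_id t).mul_const _)
    rw [h.deriv]; ring
  have hmean : ∫ t in (0 : ℝ)..1, (t - 1 / 2) = 0 := by
    rw [intervalIntegral.integral_sub intervalIntegral.intervalIntegrable_id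
      intervalIntegrable_const, integral_id, intervalIntegral.integral_const]
    norm_num
  have hintegrand (t : ℝ) : (1 - t) * a₀ + t * a₁ -
      ((1 - 0) * a₀ + 0 * a₁ + ((1 - 1) * a₀ + 1 * a₁)) / 2 = (t - 1 / 2) * (a₁ - a₀) := by
    ring
  simp only [pathDefect, hderiv, hintegrand, intervalIntegral.integral_mul_const]
  rw [hmean, zero_mul, zero_mul]

theorem setIntegral_triangle_fderiv_snd {Q : ℝ × ℝ → ℝ} (hQ : ContDiff ℝ 1 Q) :
    ∫ y in triangle, fderiv ℝ Q y (0, 1) = ∫ s in (0 : ℝ)..1, (Q (s, 1 - s) - Q (s, 0)) := by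
  have hc : Continuous (fun y => fderiv ℝ Q y (0, 1)) :=
    (hQ.continuous_fderiv one_ne_zero).clm_apply continuous_const
  rw [setIntegral_triangle hc]
  congr 1
  ext s
  have hd : ∀ t, HasDerivAt (fun t => Q (s, t)) (fderiv ℝ Q (s, t) (0, 1)) t := fun t =>
    ((hQ.differentiable one_ne_zero (s, t)).hasFDerivAt).comp_hasDerivAt t
      ((hasDerivAt_const t s).prodMk (hasDerivAt_id t))
  exact intervalIntegral.integral_eq_sub_of_hasDerivAt (fun t _ => hd t)
    ((hc.comp (by fun_prop : Continuous fun t => ((s, t) : ℝ × ℝ))).intervalIntegrable _ _)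

theorem setIntegral_triangle_fderiv_fst {P : ℝ × ℝ → ℝ} (hP : ContDiff ℝ 1 P) :
    ∫ y in triangle, fderiv ℝ P y (1, 0) = ∫ t in (0 : ℝ)..1, (P (1 - t, t) - P (0, t)) := by
  have hc : Continuous (fun y => fderiv ℝ P y (1, 0)) :=
    (hP.continuous_fderiv one_ne_zero).clm_apply continuous_const
  rw [setIntegral_triangle_swap hc]
  congr 1
  ext t
  have hd : ∀ s, HasDerivAt (fun s => P (s, t)) (fderiv ℝ P (s, t) (1, 0)) s := fun s =>
    ((hP.differentiable one_ne_zero (s, t)).hasFDerivAt).comp_hasDerivAt s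
      ((hasDerivAt_id s).prodMk (hasDerivAt_const s t))
  exact intervalIntegral.integral_eq_sub_of_hasDerivAt (fun s _ => hd s)
    ((hc.comp (by fun_prop : Continuous fun s => ((s, t) : ℝ × ℝ))).intervalIntegrable _ _)

theorem fderiv_wedge_eq {a b : ℝ × ℝ → ℝ} (ha : Differentiable ℝ a) (hb : ContDiff ℝ 2 b)
    (y v w : ℝ × ℝ) :
    fderiv ℝ a y v * fderiv ℝ b y w - fderiv ℝ a y w * fderiv ℝ b y v =
      fderiv ℝ (fun y => a y * fderiv ℝ b y w) y v -
        fderiv ℝ (fun y => a y * fderiv ℝ b y v) y w := by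
  have hd : Differentiable ℝ (fderiv ℝ b) :=
    (hb.fderiv_right (m := 1) le_rfl).differentiable one_ne_zero
  have hd' (v : ℝ × ℝ) : DifferentiableAt ℝ (fun y => fderiv ℝ b y v) y :=
    (hd y).clm_apply (differentiableAt_const v)
  have hsymm : fderiv ℝ (fun y => fderiv ℝ b y w) y v = fderiv ℝ (fun y => fderiv ℝ b y v) y w := by
    rw [fderiv_clm_apply (hd y) (differentiableAt_const _),
      fderiv_clm_apply (hd y) (differentiableAt_const _)]
    simpa using hb.contDiffAt.isSymmSndFDerivAt (by simp) v w
  rw [fderiv_fun_mul (ha y) (hd' w), fderiv_fun_mul (ha y) (hd' v)]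
  simp only [add_apply, smul_apply, smul_eq_mul, hsymm]
  ring

theorem deriv_comp_curve {b : ℝ × ℝ → ℝ} (hb : Differentiable ℝ b) {c : ℝ → ℝ × ℝ} {v : ℝ × ℝ}
    {t : ℝ} (hc : HasDerivAt c v t) : deriv (fun t => b (c t)) t = fderiv ℝ b (c t) v :=
  ((hb (c t)).hasFDerivAt.comp_hasDerivAt t hc).deriv

theorem setIntegral_triangle_wedge_eq_boundary {a b : ℝ × ℝ → ℝ} (ha : ContDiff ℝ 1 a)
    (hb : ContDiff ℝ 2 b) :
    ∫ y in triangle, (fderiv ℝ a y (1, 0) * fderiv ℝ b y (0, 1) -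
        fderiv ℝ a y (0, 1) * fderiv ℝ b y (1, 0)) =
      (∫ t in (0 : ℝ)..1, a (1 - t, t) * deriv (fun t => b (1 - t, t)) t) -
      (∫ t in (0 : ℝ)..1, a (0, t) * deriv (fun t => b (0, t)) t) +
      ∫ t in (0 : ℝ)..1, a (t, 0) * deriv (fun t => b (t, 0)) t := by
  have hform (v : ℝ × ℝ) : ContDiff ℝ 1 (fun y => a y * fderiv ℝ b y v) :=
    ha.mul ((hb.fderiv_right (m := 1) le_rfl).clm_apply contDiff_const)
  have hd : Differentiable ℝ b := hb.differentiable two_ne_zero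
  have hint (v w : ℝ × ℝ) :
      IntegrableOn (fun y => fderiv ℝ (fun y => a y * fderiv ℝ b y v) y w) triangle :=
    (((hform v).continuous_fderiv one_ne_zero).clm_apply
      continuous_const).continuousOn.integrableOn_compact isCompact_triangle
  have hcurve (v : ℝ × ℝ) (c : ℝ → ℝ × ℝ) (hc : Continuous c) :
      IntervalIntegrable (fun t => a (c t) * fderiv ℝ b (c t) v) volume 0 1 :=
    ((hform v).continuous.comp hc).intervalIntegrable _ _
  have hderiv_hyp (t : ℝ) : deriv (fun t => b (1 - t, t)) t =
      fderiv ℝ b (1 - t, t) (0, 1) - fderiv ℝ b (1 - t, t) (1, 0) := by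
    refine (deriv_comp_curve hd (c := fun t => (1 - t, t))
      (((hasDerivAt_id t).const_sub 1).prodMk (hasDerivAt_id t))).trans ?_
    rw [← map_sub]; simp
  have hderiv_fst (t : ℝ) : deriv (fun t => b (0, t)) t = fderiv ℝ b (0, t) (0, 1) :=
    deriv_comp_curve hd ((hasDerivAt_const t (0 : ℝ)).prodMk (hasDerivAt_id t))
  have hderiv_snd (t : ℝ) : deriv (fun t => b (t, 0)) t = fderiv ℝ b (t, 0) (1, 0) :=
    deriv_comp_curve hd ((hasDerivAt_id t).prodMk (hasDerivAt_const t (0 : ℝ)))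
  have hflip := intervalIntegral.integral_comp_sub_left (a := 0) (b := 1)
    (fun t => a (t, 1 - t) * fderiv ℝ b (t, 1 - t) (1, 0)) 1
  simp only [sub_sub_cancel, sub_zero, sub_self] at hflip
  simp_rw [fderiv_wedge_eq (ha.differentiable one_ne_zero) hb, hderiv_hyp, hderiv_fst, hderiv_snd,
    mul_sub]
  rw [integral_sub (hint _ _) (hint _ _), setIntegral_triangle_fderiv_fst (hform _),
    setIntegral_triangle_fderiv_snd (hform _),
    intervalIntegral.integral_sub (hcurve _ _ (by fun_prop)) (hcurve _ _ (by fun_prop)),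
    intervalIntegral.integral_sub (hcurve _ _ (by fun_prop)) (hcurve _ _ (by fun_prop)),
    intervalIntegral.integral_sub (hcurve _ _ (by fun_prop)) (hcurve _ _ (by fun_prop)), hflip]
  ring

theorem setIntegral_triangle_wedge {a b : ℝ × ℝ → ℝ} (ha : ContDiff ℝ 1 a) (hb : ContDiff ℝ 2 b) :
    ∫ y in triangle, (fderiv ℝ a y (1, 0) * fderiv ℝ b y (0, 1) -
        fderiv ℝ a y (0, 1) * fderiv ℝ b y (1, 0)) =
      ((a (1, 0) - a (0, 0)) * (b (0, 1) - b (0, 0)) -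
        (a (0, 1) - a (0, 0)) * (b (1, 0) - b (0, 0))) / 2 +
      (pathDefect (fun t => a (1 - t, t)) (fun t => b (1 - t, t)) -
        pathDefect (fun t => a (0, t)) (fun t => b (0, t)) +
        pathDefect (fun t => a (t, 0)) (fun t => b (t, 0))) := by
  have hb₁ : ContDiff ℝ 1 b := hb.of_le one_le_two
  rw [setIntegral_triangle_wedge_eq_boundary ha hb, pathDefect_eq_sub (by fun_prop) (by fun_prop),
    pathDefect_eq_sub (by fun_prop) (by fun_prop), pathDefect_eq_sub (by fun_prop) (by fun_prop)]
  simp only [sub_zero, sub_self]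
  ring

end Stokes

/-! ### Coordinates on the third exterior power -/

/-- Order embeddings of `{0 < 1 < 2}` as increasing triples, the index set of the sum in
`sThetaFun`. -/
def orderEmbTriple (I : Type*) [LinearOrder I] :
    (Fin 3 ↪o I) ≃ {J : I × I × I // J.1 < J.2.1 ∧ J.2.1 < J.2.2} where
  toFun f := ⟨(f 0, f 1, f 2), f.strictMono (by decide), f.strictMono (by decide)⟩
  invFun J := OrderEmbedding.ofStrictMono ![J.1.1, J.1.2.1, J.1.2.2]
    (Fin.strictMono_iff_lt_succ.mpr fun i => by
      fin_cases i
      · exact J.2.1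
      · exact J.2.2)
  left_inv f := by ext i; fin_cases i <;> rfl
  right_inv _ := rfl

theorem orderEmbTriple_coe {I : Type*} [LinearOrder I] (f : Fin 3 ↪o I) :
    (orderEmbTriple I f : I × I × I) = (f 0, f 1, f 2) := rfl

theorem wedge_eq_sum_basis {A M I : Type*} [CommRing A] [AddCommGroup M] [Module A M]
    [LinearOrder I] [Fintype I] (ε : Module.Basis I A M) (a b c : M) :
    wedge A a b c = ∑ J : I × I × I with J.1 < J.2.1 ∧ J.2.1 < J.2.2,
      (ε.repr a J.1 * (ε.repr b J.2.1 * ε.repr c J.2.2 - ε.repr b J.2.2 * ε.repr c J.2.1) -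
        ε.repr a J.2.1 * (ε.repr b J.1 * ε.repr c J.2.2 - ε.repr b J.2.2 * ε.repr c J.1) +
        ε.repr a J.2.2 * (ε.repr b J.1 * ε.repr c J.2.1 - ε.repr b J.2.1 * ε.repr c J.1)) •
        wedge A (ε J.1) (ε J.2.1) (ε J.2.2) := by
  rw [Finset.sum_subtype _ fun J => by rw [Finset.mem_filter_univ],
    ← (ε.exteriorPower 3).sum_repr (wedge A a b c)]
  refine Fintype.sum_equiv
    (Set.powersetCard.ofFinEmbEquiv.symm.trans (orderEmbTriple I)) _ _ fun s => ?_
  congr 1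
  · rw [exteriorPower.basis_repr_apply, wedge, exteriorPower.ιMultiDual_apply_ιMulti,
      Matrix.det_fin_three]
    simp only [Equiv.trans_apply, orderEmbTriple_coe, Matrix.of_apply, Module.Basis.coord_apply,
      Matrix.cons_val]
    ring
  · rw [exteriorPower.basis_apply]
    refine congrArg (exteriorPower.ιMulti A 3) (funext fun i => ?_)
    fin_cases i <;> rfl

namespace MGraph

variable {V E : Type*} {G : MGraph V E} {g : ℕ} (b : Module.Basis (Fin g) ℤ G.H1)

/-- The basis `ε_i` of `N_ℝ`. -/
def epsBasis : Module.Basis (Fin g) ℝ (G.Coh ℝ) := .ofEquivFun (coords b)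

theorem epsBasis_apply (i : Fin g) : epsBasis b i = G.eps b i := by
  refine (coords b).injective ?_
  rw [epsBasis, Module.Basis.coe_ofEquivFun, LinearEquiv.apply_symm_apply]
  ext j
  simp [eps_apply, Finsupp.single_apply, Pi.single_apply, eq_comm]

theorem epsBasis_repr_apply (u : G.Coh ℝ) (i : Fin g) : (epsBasis b).repr u i = u (b i) := rfl

/-- The functional `n ↦ 2 ∑_{i<j<k} (n_i w_jk - n_j w_ik + n_k w_ij) ε_i ∧ ε_j ∧ ε_k`. The values
`w γ γ'` play the role of the integrals of `dz_γ ∧ dz_γ'`, see `sThetaFun_eq_contractForm`. -/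
def contractForm (w : G.H1 → G.H1 → ℝ) : G.N →ₗ[ℤ] ⋀[ℝ]^3 (G.Coh ℝ) :=
  AddMonoidHom.toIntLinearMap
    { toFun := fun n =>
        ∑ I : Fin g × Fin g × Fin g with I.1 < I.2.1 ∧ I.2.1 < I.2.2,
          (2 * ((n (b I.1) : ℝ) * w (b I.2.1) (b I.2.2)
            - (n (b I.2.1) : ℝ) * w (b I.1) (b I.2.2)
            + (n (b I.2.2) : ℝ) * w (b I.1) (b I.2.1))) •
          wedge ℝ (G.eps b I.1) (G.eps b I.2.1) (G.eps b I.2.2)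
      map_zero' := by simp
      map_add' := fun n n' => by
        rw [← Finset.sum_add_distrib]
        refine Finset.sum_congr rfl fun I _ => ?_
        rw [← add_smul]
        congr 1
        simp only [N.add_apply, Int.cast_add]
        ring }

theorem contractForm_apply (w : G.H1 → G.H1 → ℝ) (n : G.N) : contractForm b w n =
    ∑ I : Fin g × Fin g × Fin g with I.1 < I.2.1 ∧ I.2.1 < I.2.2,
      (2 * ((n (b I.1) : ℝ) * w (b I.2.1) (b I.2.2)
        - (n (b I.2.1) : ℝ) * w (b I.1) (b I.2.2)
        + (n (b I.2.2) : ℝ) * w (b I.1) (b I.2.1))) •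
      wedge ℝ (G.eps b I.1) (G.eps b I.2.1) (G.eps b I.2.2) := rfl

theorem contractForm_add (w w' : G.H1 → G.H1 → ℝ) :
    contractForm b (w + w') = contractForm b w + contractForm b w' := by
  ext1 n
  simp only [contractForm_apply, LinearMap.add_apply, ← Finset.sum_add_distrib]
  refine Finset.sum_congr rfl fun I _ => ?_
  rw [← add_smul]
  congr 1
  simp only [Pi.add_apply]
  ring

theorem contractForm_zero : contractForm b 0 = 0 :=
  left_eq_add.mp ((congrArg _ (add_zero 0).symm).trans (contractForm_add b 0 0))

theorem contractForm_sub (w w' : G.H1 → G.H1 → ℝ) :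
    contractForm b (w - w') = contractForm b w - contractForm b w' := by
  rw [eq_sub_iff_add_eq, ← contractForm_add, sub_add_cancel]

/-- The normalization in `sThetaFun` makes the contraction of the constant form with the areas of
an affine triangle equal to the wedge product with its edges `u`, `u'`. -/
theorem contractForm_affine (u u' : G.Coh ℝ) (n : G.N) :
    contractForm b (fun γ γ' => (u γ * u' γ' - u' γ * u γ') / 2) n =
      wedge ℝ (G.toCoh ℝ n) u u' := by
  rw [wedge_eq_sum_basis (epsBasis b), contractForm_apply]
  refine Finset.sum_congr rfl fun I _ => ?_
  simp only [epsBasis_apply, epsBasis_repr_apply, toCoh_apply]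
  congr 1
  ring

end MGraph

/-! ### Straightening of smooth simplices -/

theorem sum_funOnFinite_linearMap_smul {R M X Y : Type*} [CommRing R] [AddCommGroup M] [Module R M]
    [Fintype X] [Fintype Y] (f : X → Y) (t : X → R) (u : Y → M) :
    ∑ y, FunOnFinite.linearMap R R f t y • u y = ∑ x, t x • u (f x) := by
  classical
  have h : Fintype.linearCombination R u ∘ₗ FunOnFinite.linearMap R R f =
      Fintype.linearCombination R (u ∘ f) := by
    ext x
    simp [FunOnFinite.linearMap_piSingle, Fintype.linearCombination_apply_single]
  simpa only [LinearMap.comp_apply, Fintype.linearCombination_apply, Function.comp_apply]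
    using LinearMap.congr_fun h t

namespace MGraph

variable {V E : Type*} {G : MGraph V E} [Fintype E] {l : E → ℝ} {q : ℕ}

theorem IsSmoothLift.face {s : G.SmoothSimplex l (q + 1)} {F : (Fin (q + 2) → ℝ) → G.Coh ℝ}
    (h : IsSmoothLift s F) (i : Fin (q + 2)) :
    IsSmoothLift (G.smFace l i s) (fun y => F (FunOnFinite.linearMap ℝ ℝ i.succAbove y)) where
  contDiff γ := (h.contDiff γ).comp
    (LinearMap.toContinuousLinearMap (FunOnFinite.linearMap ℝ ℝ i.succAbove)).contDiff
  mk_eq y := h.mk_eq (stdSimplex.map i.succAbove y)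

theorem isSmoothLift_affine (u : Fin (q + 1) → G.Coh ℝ) :
    IsSmoothLift (G.affine l u) (fun y => ∑ i, y i • u i) where
  contDiff γ := by
    simp only [Coh.sum_apply, Coh.smul_apply]
    fun_prop
  mk_eq _ := rfl

theorem affine_add_const {a : G.Coh ℝ} (ha : a ∈ G.lattice l) (u : Fin (q + 1) → G.Coh ℝ) :
    G.affine l (fun i => u i + a) = G.affine l u := by
  refine Subtype.ext (funext fun t => ?_)
  have h : ∑ i, t i • (u i + a) = ∑ i, t i • u i + a := by
    simp only [smul_add, Finset.sum_add_distrib, ← Finset.sum_smul, stdSimplex.sum_eq_one, one_smul]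
  exact (congrArg _ h).trans (QuotientAddGroup.mk_add_of_mem _ ha)

/-- The affine simplex of `Jac(C)` attached to an ordered simplex. -/
def affineOrd : OrdSimplex (G.lattice l) q → G.SmoothSimplex l q :=
  Quotient.lift (G.affine l) (by
    rintro u u' ⟨a, ha, h⟩
    rw [funext h, affine_add_const ha])

theorem affineOrd_ordMk (u : Fin (q + 1) → G.Coh ℝ) :
    affineOrd (ordMk (G.lattice l) u) = G.affine l u := rfl

theorem smFace_affineOrd (i : Fin (q + 2)) (s : OrdSimplex (G.lattice l) (q + 1)) :
    G.smFace l i (affineOrd s) = affineOrd (ordFace (G.lattice l) i s) := by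
  induction s using Quotient.inductionOn with
  | h u =>
    exact Subtype.ext (funext fun t => congrArg (QuotientAddGroup.mk' (G.lattice l))
      (sum_funOnFinite_linearMap_smul i.succAbove t u))

theorem sBdry_eq_bdryChain : G.sBdry l q = bdryChain G.N (G.smFace l) := rfl

theorem sBdry_pushChain_affineOrd (c : G.UChain l (q + 1)) :
    G.sBdry l q (pushChain G.N affineOrd c) = pushChain G.N affineOrd (G.uBdry l q c) :=
  bdryChain_pushChain smFace_affineOrd c

theorem pushChain_affineOrd_symEdge (n : G.N) (u v : G.Coh ℝ) :
    pushChain G.N affineOrd (n ⊗ₜ[ℤ] symEdge (G.lattice l) u v) = n ⊗ₜ[ℤ]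
      (FreeAbelianGroup.of (G.affine l ![u, v]) + FreeAbelianGroup.of (G.affine l ![-u, -v])) := by
  rw [pushChain_tmul, symEdge, map_add, FreeAbelianGroup.map_of_apply,
    FreeAbelianGroup.map_of_apply, affineOrd_ordMk, affineOrd_ordMk]

theorem pushChain_affineOrd_ordCer (p : Point (V := V) l) :
    pushChain G.N affineOrd (G.ordCer l p) = G.sCer l p := by
  simp only [sCer, ordCer, map_sum, map_list_sum, List.map_map, Function.comp_def,
    pushChain_affineOrd_symEdge]

theorem exists_sBdry_eq_sCer (p : Point (V := V) l) : ∃ S, G.sBdry l 1 S = G.sCer l p := by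
  obtain ⟨S, hS⟩ := G.exists_uBdry_eq_ordCer p
  exact ⟨pushChain G.N affineOrd S, by
    rw [sBdry_pushChain_affineOrd, hS, pushChain_affineOrd_ordCer]⟩

variable {g : ℕ} (b : Module.Basis (Fin g) ℤ G.H1) (hl : ∀ e, 0 < l e)

/-- A chosen lift of a smooth simplex to `N_ℝ`. -/
def smoothLift (s : G.SmoothSimplex l q) : (Fin (q + 1) → ℝ) → G.Coh ℝ :=
  (exists_isSmoothLift b hl s).choose

theorem isSmoothLift_smoothLift (s : G.SmoothSimplex l q) : IsSmoothLift s (smoothLift b hl s) :=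
  (exists_isSmoothLift b hl s).choose_spec

/-- The ordered simplex formed by the vertices of a lift of a smooth simplex. -/
def straighten (s : G.SmoothSimplex l q) : OrdSimplex (G.lattice l) q :=
  ordMk _ fun i => smoothLift b hl s (Pi.single i 1)

theorem IsSmoothLift.straighten_eq {s : G.SmoothSimplex l q} {F : (Fin (q + 1) → ℝ) → G.Coh ℝ}
    (h : IsSmoothLift s F) : straighten b hl s = ordMk _ fun i => F (Pi.single i 1) := by
  obtain ⟨a, ha, hadd⟩ := (isSmoothLift_smoothLift b hl s).exists_eq_add b hl h
  exact ordMk_eq_ordMk ha fun i => hadd _ (single_mem_stdSimplex ℝ i)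

theorem ordFace_straighten (i : Fin (q + 2)) (s : G.SmoothSimplex l (q + 1)) :
    ordFace _ i (straighten b hl s) = straighten b hl (G.smFace l i s) := by
  rw [((isSmoothLift_smoothLift b hl s).face i).straighten_eq b hl, straighten, ordFace_ordMk]
  simp only [FunOnFinite.linearMap_piSingle]

theorem straighten_affine (u : Fin (q + 1) → G.Coh ℝ) :
    straighten b hl (G.affine l u) = ordMk _ u := by
  rw [(isSmoothLift_affine u).straighten_eq b hl]
  simp only [Pi.single_apply, ite_smul, one_smul, zero_smul, Finset.sum_ite_eq', Finset.mem_univ,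
    if_true]

theorem uBdry_pushChain_straighten (c : G.SChain l (q + 1)) :
    G.uBdry l q (pushChain G.N (straighten b hl) c) =
      pushChain G.N (straighten b hl) (G.sBdry l q c) :=
  bdryChain_pushChain (ordFace_straighten b hl) c

theorem pushChain_straighten_affineOrd (c : G.UChain l q) :
    pushChain G.N (straighten b hl) (pushChain G.N affineOrd c) = c := by
  rw [pushChain_pushChain, pushChain_eq_self fun s => ?_]
  induction s using Quotient.inductionOn with
  | h u => exact straighten_affine b hl u

end MGraph

/-! ### Integration over a smooth triangle and over its straightening -/

/-- The parametrization of the standard 2-simplex used by `integral2`. -/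
def simplexPoint (y : ℝ × ℝ) : Fin 3 → ℝ := ![1 - y.1 - y.2, y.1, y.2]

theorem contDiff_simplexPoint {n : ℕ∞} : ContDiff ℝ n simplexPoint := by
  refine contDiff_pi.mpr fun i => ?_
  fin_cases i
  · exact (contDiff_const.sub contDiff_fst).sub contDiff_snd
  · exact contDiff_fst
  · exact contDiff_snd

theorem simplexPoint_mem {y : ℝ × ℝ} (hy : y ∈ triangle) :
    simplexPoint y ∈ stdSimplex ℝ (Fin 3) := by
  obtain ⟨h1, h2, h3⟩ := hy
  rw [stdSimplex, Set.mem_ofPred_eq, Fin.forall_fin_succ, Fin.forall_fin_two, Fin.sum_univ_three]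
  exact ⟨⟨by simpa only [sub_sub, simplexPoint, Matrix.cons_val_zero] using sub_nonneg.mpr h3,
    h1, h2⟩, by
    simp only [simplexPoint, Matrix.cons_val]; ring⟩

theorem simplexPoint_add_smul_fst (y : ℝ × ℝ) (τ : ℝ) : simplexPoint (y + τ • (1, 0)) =
    simplexPoint y + τ • (Pi.single 1 1 - Pi.single 0 1) := by
  ext i; fin_cases i <;> simp [simplexPoint]; ring

theorem simplexPoint_add_smul_snd (y : ℝ × ℝ) (τ : ℝ) : simplexPoint (y + τ • (0, 1)) =
    simplexPoint y + τ • (Pi.single 2 1 - Pi.single 0 1) := by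
  ext i; fin_cases i <;> simp [simplexPoint]; ring

theorem simplexPoint_zero_zero : simplexPoint (0, 0) = Pi.single 0 1 := by
  ext i; fin_cases i <;> simp [simplexPoint]

theorem simplexPoint_one_zero : simplexPoint (1, 0) = Pi.single 1 1 := by
  ext i; fin_cases i <;> simp [simplexPoint]

theorem simplexPoint_zero_one : simplexPoint (0, 1) = Pi.single 2 1 := by
  ext i; fin_cases i <;> simp [simplexPoint]

theorem linearMap_succAbove_edgePoint (i : Fin 3) (t : ℝ) :
    FunOnFinite.linearMap ℝ ℝ i.succAbove ![1 - t, t] =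
      (1 - t) • Pi.single (i.succAbove 0) 1 + t • Pi.single (i.succAbove 1) 1 := by
  have h : (![1 - t, t] : Fin 2 → ℝ) = (1 - t) • Pi.single 0 1 + t • Pi.single 1 1 := by
    ext j; fin_cases j <;> simp
  simp only [h, map_add, map_smul, FunOnFinite.linearMap_piSingle]

theorem linearMap_edgePoint_zero (t : ℝ) :
    FunOnFinite.linearMap ℝ ℝ (0 : Fin 3).succAbove ![1 - t, t] = simplexPoint (1 - t, t) := by
  rw [linearMap_succAbove_edgePoint]
  ext i; fin_cases i <;> simp [simplexPoint, Fin.succAbove]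

theorem linearMap_edgePoint_one (t : ℝ) :
    FunOnFinite.linearMap ℝ ℝ (1 : Fin 3).succAbove ![1 - t, t] = simplexPoint (0, t) := by
  rw [linearMap_succAbove_edgePoint]
  ext i; fin_cases i <;> simp [simplexPoint, Fin.succAbove]

theorem linearMap_edgePoint_two (t : ℝ) :
    FunOnFinite.linearMap ℝ ℝ (2 : Fin 3).succAbove ![1 - t, t] = simplexPoint (t, 0) := by
  rw [linearMap_succAbove_edgePoint]
  ext i; fin_cases i <;> simp [simplexPoint, Fin.succAbove]

theorem edgePoint_mem {t : ℝ} (ht : t ∈ Set.Icc (0 : ℝ) 1) :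
    ![1 - t, t] ∈ stdSimplex ℝ (Fin 2) := by
  rw [stdSimplex, Set.mem_ofPred_eq, Fin.forall_fin_two, Fin.sum_univ_two]
  exact ⟨⟨sub_nonneg.mpr ht.2, ht.1⟩, sub_add_cancel 1 t⟩

theorem fderiv_comp_of_line_eq {D D' : Type*} [NormedAddCommGroup D] [NormedSpace ℝ D]
    [NormedAddCommGroup D'] [NormedSpace ℝ D'] {f : D' → ℝ} {c : D → D'} {y d : D} {v : D'}
    (hf : DifferentiableAt ℝ f (c y)) (hc : DifferentiableAt ℝ c y)
    (h : ∀ τ : ℝ, c (y + τ • d) = c y + τ • v) :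
    fderiv ℝ (fun y => f (c y)) y d = fderiv ℝ f (c y) v := by
  have hline : HasDerivAt (fun τ : ℝ => f (c (y + τ • d))) (fderiv ℝ (fun y => f (c y)) y d) 0 :=
    (hf.comp y hc).hasFDerivAt.hasLineDerivAt d
  simp only [h] at hline
  exact hline.unique (hf.hasFDerivAt.hasLineDerivAt v)

namespace MGraph

open Filter Topology

variable {V E : Type*} {G : MGraph V E} [Fintype E] {l : E → ℝ} {q g : ℕ}
  (b : Module.Basis (Fin g) ℤ G.H1) (hl : ∀ e, 0 < l e)

namespace IsSmoothLift

variable {s : G.SmoothSimplex l q} {F : (Fin (q + 1) → ℝ) → G.Coh ℝ}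

include b hl in
theorem eventually_eq_add {f : (Fin (q + 1) → ℝ) → G.Coh ℝ} {t : Fin (q + 1) → ℝ}
    (h : IsSmoothLift s F) (hf : G.IsLocalLift l s.1 t f) (ht : t ∈ stdSimplex ℝ (Fin (q + 1))) :
    ∀ᶠ y in 𝓝[stdSimplex ℝ (Fin (q + 1))] t, f y = F y + (f t - F t) := by
  have := discreteTopology_coordLattice b hl
  have hf' := hf.isSmoothLiftNear b
  have hsub := eventually_sub_eq_of_mk_eq (L := coordLattice b l) (t := ⟨t, ht⟩)
    ((h.contDiff_coords b).continuous.comp continuous_subtype_val).continuousAt hf'.continuousAt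
    (hf'.eventually_mk_eq.mono fun y hy => (congrArg (jacEquiv b l) (h.mk_eq y)).trans hy.symm)
  refine (eventually_nhds_subtype_iff _ ⟨t, ht⟩ _).mp ?_
  filter_upwards [hsub] with y hy
  refine eq_add_of_sub_eq' ((coords b).injective ?_)
  rw [map_sub, map_sub]
  exact hy

include b hl in
/-- A local lift and a global one differ by a constant on the simplex, so they have the same
derivative along any line that stays in the simplex near `t`. -/
theorem partialD_eq (h : IsSmoothLift s F) (γ : G.H1) {k : Fin (q + 1)}
    {t : Fin (q + 1) → ℝ} (ht : t ∈ stdSimplex ℝ (Fin (q + 1)))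
    (hline : ∀ᶠ τ : ℝ in 𝓝 0, t + τ • (Pi.single k 1 - Pi.single 0 1) ∈
      stdSimplex ℝ (Fin (q + 1))) :
    G.partialD l s γ k t = fderiv ℝ (fun y => F y γ) t (Pi.single k 1 - Pi.single 0 1) := by
  have hlocal : G.IsLocalLift l s.1 t (G.localLift l s t) := Classical.epsilon_spec (s.2 ⟨t, ht⟩)
  have heq := h.eventually_eq_add b hl hlocal ht
  obtain ⟨U, hU, htU, hf, -⟩ := hlocal
  rw [partialD]
  set f := G.localLift l s t
  set d : Fin (q + 1) → ℝ := Pi.single k 1 - Pi.single 0 1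
  have hfd : HasDerivAt (fun τ : ℝ => f (t + τ • d) γ) (fderiv ℝ (fun y => f y γ) t d) 0 :=
    (((hf γ).contDiffAt (hU.mem_nhds htU)).differentiableAt (by simp)).hasFDerivAt.hasLineDerivAt d
  have hFd : HasDerivAt (fun τ : ℝ => F (t + τ • d) γ) (fderiv ℝ (fun y => F y γ) t d) 0 :=
    ((h.contDiff γ).differentiable (by simp) t).hasFDerivAt.hasLineDerivAt d
  have hlim : Tendsto (fun τ : ℝ => t + τ • d) (𝓝 0) (𝓝[stdSimplex ℝ (Fin (q + 1))] t) := by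
    refine tendsto_nhdsWithin_iff.mpr ⟨?_, hline⟩
    exact Continuous.tendsto' (by fun_prop) _ _ (by rw [zero_smul, add_zero])
  refine hfd.unique ((hFd.add_const ((f t - F t) γ)).congr_of_eventuallyEq ?_)
  filter_upwards [hlim.eventually heq] with τ hτ
  rw [hτ, Coh.add_apply]

include b hl in
theorem partialD_simplexPoint {s : G.SmoothSimplex l 2} {F : (Fin 3 → ℝ) → G.Coh ℝ}
    (h : IsSmoothLift s F) (γ : G.H1) {k : Fin 3} {y d : ℝ × ℝ} (hy : y ∈ interior triangle)
    (hd : ∀ τ : ℝ, simplexPoint (y + τ • d) =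
      simplexPoint y + τ • (Pi.single k 1 - Pi.single 0 1)) :
    G.partialD l s γ k (simplexPoint y) = fderiv ℝ (fun y => F (simplexPoint y) γ) y d := by
  have hline : ∀ᶠ τ : ℝ in 𝓝 0, y + τ • d ∈ triangle :=
    (Continuous.tendsto' (by fun_prop) 0 y (by rw [zero_smul, add_zero])).eventually
      (mem_interior_iff_mem_nhds.mp hy)
  rw [h.partialD_eq b hl γ (simplexPoint_mem (interior_subset hy))
    (hline.mono fun τ hτ => hd τ ▸ simplexPoint_mem hτ)]
  exact (fderiv_comp_of_line_eq (f := fun y => F y γ)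
    ((h.contDiff γ).differentiable (by simp) _)
    ((contDiff_simplexPoint (n := 1)).differentiable (by simp) _) hd).symm

end IsSmoothLift

/-- The functional by which the integral of `dz_γ ∧ dz_γ'` changes when an edge of a triangle is
straightened. -/
def edgeDefect (s : G.SmoothSimplex l 1) (γ γ' : G.H1) : ℝ :=
  pathDefect (fun t => smoothLift b hl s ![1 - t, t] γ) (fun t => smoothLift b hl s ![1 - t, t] γ')

theorem IsSmoothLift.edgeDefect_eq {s : G.SmoothSimplex l 1} {F : (Fin 2 → ℝ) → G.Coh ℝ}
    (h : IsSmoothLift s F) (γ γ' : G.H1) : edgeDefect b hl s γ γ' =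
      pathDefect (fun t => F ![1 - t, t] γ) (fun t => F ![1 - t, t] γ') := by
  obtain ⟨a, -, hadd⟩ := h.exists_eq_add b hl (isSmoothLift_smoothLift b hl s)
  have hγ (γ : G.H1) (t : ℝ) (ht : t ∈ Set.Icc (0 : ℝ) 1) :
      smoothLift b hl s ![1 - t, t] γ = F ![1 - t, t] γ + a γ := by
    rw [hadd _ (edgePoint_mem ht), Coh.add_apply]
  exact pathDefect_add_const (hγ γ) (hγ γ')

theorem edgeDefect_affine (u : Fin 2 → G.Coh ℝ) : edgeDefect b hl (G.affine l u) = 0 := by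
  have hval (γ : G.H1) (t : ℝ) :
      (∑ i, (![1 - t, t] : Fin 2 → ℝ) i • u i) γ = (1 - t) * u 0 γ + t * u 1 γ := by
    rw [Fin.sum_univ_two]
    rfl
  ext γ γ'
  refine ((isSmoothLift_affine u).edgeDefect_eq b hl γ γ').trans
    (Eq.trans ?_ (pathDefect_affine (u 0 γ) (u 1 γ) (u 0 γ') (u 1 γ')))
  exact congrArg₂ pathDefect (funext (hval γ)) (funext (hval γ'))

namespace IsSmoothLift

variable {s : G.SmoothSimplex l 2} {F : (Fin 3 → ℝ) → G.Coh ℝ}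

include b hl in
theorem integral2_eq_setIntegral (h : IsSmoothLift s F) (γ γ' : G.H1) :
    G.integral2 l s γ γ' = ∫ y in triangle,
      (fderiv ℝ (fun y => F (simplexPoint y) γ) y (1, 0) *
        fderiv ℝ (fun y => F (simplexPoint y) γ') y (0, 1) -
      fderiv ℝ (fun y => F (simplexPoint y) γ) y (0, 1) *
        fderiv ℝ (fun y => F (simplexPoint y) γ') y (1, 0)) := by
  refine MeasureTheory.setIntegral_congr_ae isCompact_triangle.measurableSet ?_
  filter_upwards [ae_mem_interior_triangle] with y hy hyT
  have h₁ γ := h.partialD_simplexPoint b hl γ (hy hyT) (simplexPoint_add_smul_fst y)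
  have h₂ γ := h.partialD_simplexPoint b hl γ (hy hyT) (simplexPoint_add_smul_snd y)
  rw [← h₁ γ, ← h₁ γ', ← h₂ γ, ← h₂ γ']
  rfl

theorem edgeDefect_smFace (h : IsSmoothLift s F) {i : Fin 3} {c : ℝ → ℝ × ℝ}
    (hc : ∀ t, FunOnFinite.linearMap ℝ ℝ i.succAbove ![1 - t, t] = simplexPoint (c t))
    (γ γ' : G.H1) : edgeDefect b hl (G.smFace l i s) γ γ' =
      pathDefect (fun t => F (simplexPoint (c t)) γ) (fun t => F (simplexPoint (c t)) γ') := by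
  simp only [← hc]
  exact (h.face i).edgeDefect_eq b hl γ γ'

theorem integral2_eq (h : IsSmoothLift s F) : G.integral2 l s =
    (fun γ γ' => ((F (Pi.single 1 1) - F (Pi.single 0 1)) γ *
        (F (Pi.single 2 1) - F (Pi.single 0 1)) γ' -
      (F (Pi.single 2 1) - F (Pi.single 0 1)) γ *
        (F (Pi.single 1 1) - F (Pi.single 0 1)) γ') / 2) +
    (edgeDefect b hl (G.smFace l 0 s) - edgeDefect b hl (G.smFace l 1 s) +
      edgeDefect b hl (G.smFace l 2 s)) := by
  ext γ γ'
  have hF (γ : G.H1) (n : ℕ) : ContDiff ℝ n fun y => F (simplexPoint y) γ :=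
    ((h.contDiff γ).of_le (by exact_mod_cast le_top)).comp (contDiff_simplexPoint (n := n))
  rw [h.integral2_eq_setIntegral b hl, setIntegral_triangle_wedge (hF γ 1) (hF γ' 2)]
  simp only [Pi.add_apply, Pi.sub_apply, Coh.sub_apply, simplexPoint_zero_zero,
    simplexPoint_one_zero, simplexPoint_zero_one, h.edgeDefect_smFace b hl linearMap_edgePoint_zero,
    h.edgeDefect_smFace b hl linearMap_edgePoint_one,
    h.edgeDefect_smFace b hl linearMap_edgePoint_two]

end IsSmoothLift

end MGraph

/-! ### Comparison of the periods -/

namespace MGraph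

variable {V E : Type*} {G : MGraph V E} [Fintype E] {l : E → ℝ} {g : ℕ}
  (b : Module.Basis (Fin g) ℤ G.H1) (hl : ∀ e, 0 < l e)

theorem sTheta_eq_evalChain : G.sTheta l b = evalChain (G.sThetaFun l b) := rfl

theorem sThetaFun_eq_contractForm (s : G.SmoothSimplex l 2) :
    G.sThetaFun l b s = contractForm b (G.integral2 l s) := rfl

theorem sThetaFun_eq_add_coboundary (s : G.SmoothSimplex l 2) (n : G.N) :
    G.sThetaFun l b s n = G.ordArea l (straighten b hl s) n +
      ∑ i : Fin 3, (-1 : ℤ) ^ (i : ℕ) • contractForm b (edgeDefect b hl (G.smFace l i s)) n := by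
  have h := isSmoothLift_smoothLift b hl s
  rw [sThetaFun_eq_contractForm, h.integral2_eq b hl, contractForm_add, contractForm_add,
    contractForm_sub, LinearMap.add_apply, contractForm_affine, straighten, ordArea_ordMk,
    Fin.sum_univ_three, LinearMap.add_apply, LinearMap.sub_apply]
  simp [sub_eq_add_neg]

theorem sTheta_eq_add (c : G.SChain l 2) :
    G.sTheta l b c = G.uTheta l (pushChain G.N (straighten b hl) c) +
      evalChain (fun s => contractForm b (edgeDefect b hl s)) (G.sBdry l 1 c) := by
  rw [sTheta_eq_evalChain, uTheta_eq_evalChain, evalChain_pushChain, sBdry_eq_bdryChain]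
  exact evalChain_add_coboundary (fun s => contractForm b (edgeDefect b hl s))
    (sThetaFun_eq_add_coboundary b hl) c

theorem evalChain_edgeDefect_pushChain_affineOrd (d : G.UChain l 1) :
    evalChain (fun s => contractForm b (edgeDefect b hl s)) (pushChain G.N affineOrd d) = 0 := by
  have hzero (s : OrdSimplex (G.lattice l) 1) :
      contractForm b (edgeDefect b hl (affineOrd s)) = 0 := by
    induction s using Quotient.inductionOn with
    | h u => exact (congrArg _ (edgeDefect_affine b hl u)).trans (contractForm_zero b)
  have : evalChain (fun s : OrdSimplex (G.lattice l) 1 =>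
      contractForm b (edgeDefect b hl (affineOrd s))) = 0 :=
    tensorFree_hom_ext fun n s => by
      rw [evalChain_tmul_of, hzero, LinearMap.zero_apply, AddMonoidHom.zero_apply]
  rw [evalChain_pushChain, this, AddMonoidHom.zero_apply]

theorem sTheta_eq_of_affine_bdry {c : G.SChain l 2} {d : G.UChain l 1}
    (h : G.sBdry l 1 c = pushChain G.N affineOrd d) :
    G.sTheta l b c = G.uTheta l (pushChain G.N (straighten b hl) c) := by
  rw [sTheta_eq_add b hl, h, evalChain_edgeDefect_pushChain_affineOrd, add_zero]

include hl in
theorem sPeriods_eq_uPeriods : G.sPeriods l b = G.uPeriods l := by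
  apply le_antisymm
  · rintro _ ⟨c, hc, rfl⟩
    rw [SetLike.mem_coe, AddMonoidHom.mem_ker] at hc
    refine ⟨pushChain G.N (straighten b hl) c, ?_, ?_⟩
    · rw [SetLike.mem_coe, AddMonoidHom.mem_ker, uBdry_pushChain_straighten, hc, map_zero]
    · rw [sTheta_eq_add b hl, hc, map_zero, add_zero]
  · rintro _ ⟨c, hc, rfl⟩
    rw [SetLike.mem_coe, AddMonoidHom.mem_ker] at hc
    have hbdry : G.sBdry l 1 (pushChain G.N affineOrd c) = 0 := by
      rw [sBdry_pushChain_affineOrd, hc, map_zero]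
    refine ⟨pushChain G.N affineOrd c, hbdry, ?_⟩
    rw [sTheta_eq_add b hl, hbdry, map_zero, add_zero, pushChain_straighten_affineOrd]

include hl in
theorem evExt_uTheta_sub_sTheta_mem (p : Point (V := V) l) (v : V)
    {S : G.UChain (vars E) 2} (hS : G.uBdry (vars E) 1 S = G.uCer (vars E) v)
    {T : G.SChain l 2} (hT : G.sBdry l 1 T = G.sCer l p) :
    G.sTheta l b T - G.evExt l (G.uTheta (vars E) S) ∈ G.sPeriods l b := by
  rw [← pushChain_affineOrd_ordCer] at hT
  obtain ⟨D, hD, hDbdry⟩ := G.ordCer_sub_uCer_mem v p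
  rw [SetLike.mem_coe, AddMonoidHom.mem_ker] at hD
  rw [sTheta_eq_of_affine_bdry b hl hT, ← uTheta_evChain, sPeriods_eq_uPeriods b hl]
  refine ⟨pushChain G.N (straighten b hl) T - G.evChain l 2 S - D, ?_, ?_⟩
  · rw [SetLike.mem_coe, AddMonoidHom.mem_ker, map_sub, map_sub, uBdry_evChain, hS, evChain_uCer,
      uBdry_pushChain_straighten, hT, pushChain_straighten_affineOrd, hDbdry, sub_self]
  · rw [map_sub, map_sub, hD, sub_zero]

include hl in
theorem mk_evExt_uTheta_eq_sAlpha (p : Point (V := V) l) (v : V) {S : G.UChain (vars E) 2}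
    (hS : G.uBdry (vars E) 1 S = G.uCer (vars E) v) :
    QuotientAddGroup.mk (G.evExt l (G.uTheta (vars E) S)) = G.sAlpha l b p := by
  rw [sAlpha, QuotientAddGroup.eq, neg_add_eq_sub]
  exact evExt_uTheta_sub_sTheta_mem b hl p v hS (Classical.epsilon_spec (exists_sBdry_eq_sCer p))

end MGraph

end Ceresa

end

theorem mainTheorem4 {V E : Type*} [Finite V] [Fintype E] (G : Ceresa.MGraph V E)
    (l : E → ℝ) (hl : ∀ e, 0 < l e) {g : ℕ} (b : Module.Basis (Fin g) ℤ G.H1) :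
    (∀ v : V, ∃ S : G.UChain (Ceresa.MGraph.vars E) 2, G.uBdry (Ceresa.MGraph.vars E) 1 S = G.uCer (Ceresa.MGraph.vars E) v) ∧
    (∀ p : Ceresa.MGraph.Point (V := V) l, ∃ S : G.SChain l 2, G.sBdry l 1 S = G.sCer l p) ∧
    ∃ h : (G.uPeriods (Ceresa.MGraph.vars E)).map (G.evExt l) = G.sPeriods l b,
      ∀ (v : V) (p : Ceresa.MGraph.Point (V := V) l),
        QuotientAddGroup.map (G.uPeriods (Ceresa.MGraph.vars E)) (G.sPeriods l b) (G.evExt l)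
            (AddSubgroup.map_le_iff_le_comap.mp h.le) (G.uAlpha (Ceresa.MGraph.vars E) v) = G.sAlpha l b p ∧
        (G.uAlpha (Ceresa.MGraph.vars E) v = 0 → G.sAlpha l b p = 0) := by
  refine ⟨G.exists_uBdry_eq_uCer _, Ceresa.MGraph.exists_sBdry_eq_sCer,
    (G.map_uPeriods hl).trans (Ceresa.MGraph.sPeriods_eq_uPeriods b hl).symm, fun v p => ?_⟩
  refine (and_iff_left_of_imp fun hα h0 => by rw [← hα, h0, map_zero]).mpr ?_
  have hS := Classical.epsilon_spec (G.exists_uBdry_eq_uCer (Ceresa.MGraph.vars E) v)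
  exact Ceresa.MGraph.mk_evExt_uTheta_eq_sAlpha b hl p v hS
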